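/- Setting. A stream $x^{(1)},\dots,x^{(T)}\in[n]$ ($n\ge 1$) has $S^{(t)}=\{x^{(1)},\dots,x^{(t)}\}$ and $F_0^{(t)}=|S^{(t)}|$. Let $C\ge 1$. A $C$-tracker is a sequence of reports $\tilde F^{(0)},\dots,\tilde F^{(T)}\in\mathbb R$ with $\frac1C F_0^{(t)}\le\tilde F^{(t)}\le C F_0^{(t)}$ for all $0\le t\le T$. A streaming algorithm with oracle access to a tracker and to random bits keeps between two stream elements only a state, written in binary by an injective code; it updates the state when an element arrives, using the element, the random bits and the tracker's reports just before and just after the element, and it computes its output from the state, the random bits and the current report. Its space $W^{(t)}$ is the number of bits of the code of the state after $t$ elements (random bits and tracker are not counted). The Kane--Nelson--Woodruff (KNW) algorithm with integer parameters $a,d,b,e\ge 0$. Put $p=a+\lceil\log_2(1/\varepsilon^2)\rceil$, $P=2^p$ and $m=\lceil\log_2 n\rceil$. It uses, with mutually independent blocks of uniform random bits, an $8$-wise independent $h_1:[n]\to\{0,\dots,2^m-1\}$, a pairwise independent $h_3:[n]\to[P^2]$ and a $p^e$-wise independent $h_4:[P^2]\to[P]$; put $h_2=h_4\circ h_3$.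 Here $k$-wise independent means that the values at any at most $k$ distinct points are independent and uniform. Let $\mathrm{lsb}(v)$ be the position, counted from $0$, of the least significant $1$ of $v$, with $\mathrm{lsb}(0)=m$. Let $D^{(t)}=\max\{0,\lfloor\log_2(\varepsilon^2\tilde F^{(t)})-d\rfloor\}$ ($D^{(t)}=0$ if $\tilde F^{(t)}=0$) and $B^{(t)}=\max\{0,D^{(t)}-b\}$. The state consists of counters $c_i\in\mathbb N$, $i\in[P]$, initially $0$. When $x^{(t)}$ arrives, each $c_i>0$ is first replaced by $\max\{0,c_i+B^{(t-1)}-B^{(t)}\}$, and then, for $i=h_2(x^{(t)})$, $c_i$ is replaced by $\max\{c_i,\ \mathrm{lsb}(h_1(x^{(t)}))+1-B^{(t)}\}$. The state is coded by the concatenation of self-delimiting codes of the $c_i$, of $2\ell(c_i)+1$ bits each, where $\ell(c)$ is the binary length of $c$ ($\ell(0)=0$). At time $t$ the algorithm reports $\Phi^{-1}(Q)\,2^{D^{(t)}}$, where $Q=\#\{i: c_i>0,\ c_i-1+B^{(t)}\ge D^{(t)}\}$, $\Phi(u)=P\,(1-(1-1/P)^u)$, and so $\Phi^{-1}(q)=\ln(1-q/P)/\ln(1-1/P)$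 for $q<P$ (and, say, $\Phi^{-1}(P)=0$). Theorem. For every $C\ge 1$ there are parameters $a,d,b,e$ and constants $j\in\mathbb N$, $K,C_2,C_3,\lambda_0\in\mathbb R$, $c>0$, depending only on $C$, such that for all $n\ge1$ and $0<\varepsilon<1$ the following holds. Hash families as required exist with at most $K\,(1+\log n+\log^j(1/\varepsilon))$ random bits in total. For any such hash families, every stream and every fixed $C$-tracker for it, the KNW algorithm satisfies, with probabilities over its random bits: 1. for every $t\le T$, with probability at least $\frac56$ its output at time $t$ lies in $[(1-\varepsilon)F_0^{(t)},(1+\varepsilon)F_0^{(t)}]$; 2. for every $t\le T$, $\mathbb P\left(W^{(t)}>\frac{C_2}{\varepsilon^2}\right)\le\varepsilon^4$; 3. for every $t\le T$ and every $\lambda\ge\lambda_0$, $\mathbb P\left(W^{(t)}>\frac{\lambda}{\varepsilon^2}\right)\le\exp(-e^{c\lambda})$; 4. for all $t_1<t_2\le T$ with $|S^{(t_1)}|\ge|S^{(t_2)}|/2$, and for every outcome of the random bits, $W^{(t_1)}\le W^{(t_2)}+\frac{C_3}{\varepsilon^2}$. -/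

import Mathlib

namespace DistinctElements

/-! Streams, strong tracking, and probabilities over uniform random bits. -/

/-- `S^(t)`: the set of distinct elements among the first `t` elements `x 0, …, x (t-1)`. -/
def seen {n : ℕ} (x : ℕ → Fin n) (t : ℕ) : Finset (Fin n) :=
  (Finset.range t).image x

/-- `F₀^(t)`: the number of distinct elements among the first `t` elements of the stream. -/
def F0 {n : ℕ} (x : ℕ → Fin n) (t : ℕ) : ℕ := (seen x t).card

/-- The reports `f t`, `t = 0, …, T`, strongly track `F₀` of the stream `x` up to the factor `C`. -/
def Tracks {n : ℕ} (C : ℝ) (T : ℕ) (x : ℕ → Fin n) (f : ℕ → ℝ) : Prop :=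
  ∀ t ≤ T, (1 / C) * (F0 x t : ℝ) ≤ f t ∧ f t ≤ C * (F0 x t : ℝ)

/-- Probability of the event `E` over `r` independent uniform random bits. -/
noncomputable def bitProb {r : ℕ} (E : Set (Fin r → Bool)) : ℝ :=
  (E.ncard : ℝ) / (2 : ℝ) ^ r

/-! Streaming algorithms with an oracle for `r` random bits and a tracking oracle. -/

/-- A streaming algorithm over the universe `Fin n` with oracle access to `r` random bits and to a
tracker of real numbers.  Only `State` is kept between two elements of the stream; it is
written down in binary by the injective map `code`.  When an element arrives, the algorithm sees the
report of the tracker before and the report after that element. -/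
structure StreamingAlgorithm (n r : ℕ) where
  State : Type
  code : State → List Bool
  code_injective : Function.Injective code
  init : State
  update : (bits : Fin r → Bool) → (state : State) → (before after : ℝ) → (item : Fin n) → State
  output : (bits : Fin r → Bool) → (state : State) → (report : ℝ) → ℝ

namespace StreamingAlgorithm

variable {n r : ℕ}

/-- The state after the first `t` elements of the stream `x`, where `f` are the tracker's reports. -/
def run (A : StreamingAlgorithm n r) (x : ℕ → Fin n) (f : ℕ → ℝ) (ω : Fin r → Bool) : ℕ → A.State
  | 0 => A.init
  | t + 1 => A.update ω (A.run x f ω t) (f t) (f (t + 1)) (x t)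

/-- `W^(t)`: the number of bits of memory in use after the first `t` elements (the random bits
and the tracker are not counted). -/
def space (A : StreamingAlgorithm n r) (x : ℕ → Fin n) (f : ℕ → ℝ) (ω : Fin r → Bool)
    (t : ℕ) : ℕ :=
  (A.code (A.run x f ω t)).length

/-- The value reported after the first `t` elements. -/
def estimate (A : StreamingAlgorithm n r) (x : ℕ → Fin n) (f : ℕ → ℝ) (ω : Fin r → Bool)
    (t : ℕ) : ℝ :=
  A.output ω (A.run x f ω t) (f t)

end StreamingAlgorithm

/-! Hash functions with limited independence. -/

/-- The family `h` of functions `α → β`, indexed by `r` uniform random bits, is `k`-wise independent: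
the values at any at most `k` distinct points are independent and uniform on `β`. -/
def KWiseIndependent {r : ℕ} {α β : Type} [Fintype β] (k : ℕ)
    (h : (Fin r → Bool) → α → β) : Prop :=
  ∀ A : Finset α, A.card ≤ k → ∀ y : α → β,
    bitProb {ω | ∀ a ∈ A, h ω a = y a} = ((Fintype.card β : ℝ)⁻¹) ^ A.card

/-- The hash functions of the algorithm, with three separate blocks of random bits: with `P = 2 ^ p`,
`h₁ : [n] → {0, …, 2 ^ ⌈log₂ n⌉ - 1}` is 8-wise independent, `h₃ : [n] → [P²]` is pairwise
independent and `h₄ : [P²] → [P]` is `k`-wise independent. -/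
structure KNWHash (n p k : ℕ) where
  r₁ : ℕ
  r₃ : ℕ
  r₄ : ℕ
  h₁ : (Fin r₁ → Bool) → Fin n → Fin (2 ^ Nat.clog 2 n)
  h₃ : (Fin r₃ → Bool) → Fin n → Fin ((2 ^ p) ^ 2)
  h₄ : (Fin r₄ → Bool) → Fin ((2 ^ p) ^ 2) → Fin (2 ^ p)
  indep₁ : KWiseIndependent 8 h₁
  indep₃ : KWiseIndependent 2 h₃
  indep₄ : KWiseIndependent k h₄

namespace KNWHash

variable {n p k : ℕ}

/-- The total number of random bits. -/
def bits (H : KNWHash n p k) : ℕ := H.r₁ + H.r₃ + H.r₄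

/-- `h₁`, read from its block of the random bits. -/
def hash₁ (H : KNWHash n p k) (ω : Fin H.bits → Bool) : Fin n → Fin (2 ^ Nat.clog 2 n) :=
  H.h₁ fun i => ω (Fin.castAdd H.r₄ (Fin.castAdd H.r₃ i))

/-- `h₂ = h₄ ∘ h₃ : [n] → [P]`, each read from its block of the random bits. -/
def hash₂ (H : KNWHash n p k) (ω : Fin H.bits → Bool) (s : Fin n) : Fin (2 ^ p) :=
  H.h₄ (fun i => ω (Fin.natAdd (H.r₁ + H.r₃) i))
    (H.h₃ (fun i => ω (Fin.castAdd H.r₄ (Fin.natAdd H.r₁ i))) s)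

end KNWHash

/-- The position of the least significant 1 of an `m`-bit number (counted from 0), and `m` for the
number 0. -/
def lsb {m : ℕ} (v : Fin (2 ^ m)) : ℕ :=
  if (v : ℕ) = 0 then m else padicValNat 2 (v : ℕ)

/-! Binary description of the counters. -/

/-- A self-delimiting binary code of `c`: the length of the binary expansion in unary, a
separator, and the binary expansion.  It has `2 * Nat.size c + 1` bits (one bit for `c = 0`). -/
def natCode (c : ℕ) : List Bool :=
  List.replicate (Nat.bits c).length true ++ false :: Nat.bits c

theorem replicate_append_inj (a b : ℕ) (l l' : List Bool)
    (h : List.replicate a true ++ false :: l = List.replicate b true ++ false :: l') :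
    a = b ∧ l = l' := by
  induction a generalizing b with
  | zero => cases b <;> simp_all [List.replicate_succ]
  | succ a ih =>
    cases b with
    | zero => simp [List.replicate_succ] at h
    | succ b =>
      simp only [List.replicate_succ, List.cons_append, List.cons.injEq, true_and] at h
      have := ih b h
      exact ⟨by omega, this.2⟩

theorem bits_inj {a b : ℕ} (h : Nat.bits a = Nat.bits b) : a = b := by
  apply Nat.eq_of_testBit_eq
  intro i
  rw [Nat.testBit_eq_inth, Nat.testBit_eq_inth, h]

theorem natCode_append_inj {a b : ℕ} {l l' : List Bool}
    (h : natCode a ++ l = natCode b ++ l') : a = b ∧ l = l' := by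
  simp only [natCode, List.append_assoc, List.cons_append] at h
  obtain ⟨h1, h2⟩ := replicate_append_inj _ _ _ _ h
  obtain ⟨h3, h4⟩ := List.append_inj h2 h1
  exact ⟨bits_inj h3, h4⟩

theorem flatMap_natCode_inj (l l' : List ℕ) (hl : l.length = l'.length)
    (h : l.flatMap natCode = l'.flatMap natCode) : l = l' := by
  induction l generalizing l' with
  | nil => cases l' <;> simp_all
  | cons a l ih =>
    cases l' with
    | nil => simp at hl
    | cons b l' =>
      simp only [List.flatMap_cons] at h
      obtain ⟨h1, h2⟩ := natCode_append_inj h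
      rw [h1, ih l' (by simpa using hl) h2]

/-- All counters one after the other. -/
def counterCode {P : ℕ} (c : Fin P → ℕ) : List Bool :=
  (List.ofFn c).flatMap natCode

theorem counterCode_injective (P : ℕ) : Function.Injective (counterCode (P := P)) := by
  intro c c' h
  exact List.ofFn_injective (flatMap_natCode_inj _ _ (by simp) h)

/-! The algorithm. -/

/-- `log₂ P` for the number `P = Θ(1/ε²)` of counters: `2^a/ε² ≤ P ≤ 2^(a+1)/ε²`. -/
noncomputable def logP (a : ℕ) (ε : ℝ) : ℕ := a + ⌈Real.logb 2 (1 / ε ^ 2)⌉₊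

/-- The subsampling level `D = ⌊log F̃₀ - log (1/ε²) - d⌋` for the report `F̃₀ = f` of the tracker,
and `0` if that is negative. -/
noncomputable def level (d : ℕ) (ε f : ℝ) : ℕ := ⌊Real.logb 2 (f * ε ^ 2) - d⌋₊

/-- Inverse of `Φ_P(t) = P (1 - (1 - 1/P)^t)`, the expected number of non-empty bins after `t`
balls are thrown into `P` bins. -/
noncomputable def PhiInv (P : ℕ) (q : ℝ) : ℝ :=
  Real.log (1 - q / P) / Real.log (1 - 1 / P)

/-- The Kane–Nelson–Woodruff algorithm with `P = 2 ^ logP a ε` counters.  Let `Z i` be the maximum of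
`lsb (h₁ s)` over the elements `s` seen so far with `h₂ s = i`.  Counter `i` holds
`Z i + 1 - (D - b)`, where `D` is the current level, and `0` marks a counter that is empty or whose
`Z i` has fallen below `D - b` (at this or an earlier level).  The margin `b` makes up for the fact
that the reports of the tracker, hence `D`, may also decrease by a bounded amount; the elements with
`lsb (h₁ s) ≥ D` are to be never lost.
The output is `Φ⁻¹(Q) 2^D` where `Q` is the number of `i` such that `Z i ≥ D`. -/
noncomputable def knw {n k : ℕ} (a d b : ℕ) (ε : ℝ) (H : KNWHash n (logP a ε) k) :
    StreamingAlgorithm n H.bits where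
  State := Fin (2 ^ logP a ε) → ℕ
  code := counterCode
  code_injective := counterCode_injective _
  init := fun _ => 0
  update := fun ω c before after s i =>
    max (if c i = 0 then 0 else c i + (level d ε before - b) - (level d ε after - b))
      (if H.hash₂ ω s = i then lsb (H.hash₁ ω s) + 1 - (level d ε after - b) else 0)
  output := fun _ c report =>
    PhiInv (2 ^ logP a ε)
        ((Finset.univ.filter fun i =>
          c i ≠ 0 ∧ level d ε report + 1 ≤ c i + (level d ε report - b)).card : ℝ)
      * 2 ^ level d ε report

end DistinctElements

open DistinctElements

namespace DistinctElements

open Finset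
open scoped BigOperators

/-! Probabilities and expectations over random bits. -/

/-! Accuracy. Tracking bounds the ratio of an earlier report to the current one, so no earlier level
exceeds the current level `D` by more than the margin `b` (`Tracks.level_le`). Elements with `lsb ≥
D` are thus never lost, and the output depends only on the bins hit by the set `A` of such elements
(`estimate_eq`). Three events can spoil it, each of probability at most 1/18: `|A| * 2 ^ D` is far
from `F0` (Chebyshev, `bitProb_sampled_le`); `h₃` has a collision on `A` (`bitProb_not_injOn_le`);
the number of empty bins is far from its mean for independent balls (`bitProb_emptyBins_le`). For
the last, truncated inclusion-exclusion shows that `p`-wise independence imitates full independence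
up to a negligible power of `1/P`, because `a` is so large that `|A| ≤ P/64`. In that range `Φ⁻¹`
has bounded slope (`abs_PhiInv_sub_le`), so the errors add up to less than `ε * F0`.

Space. Each counter is bounded by `lsb + 1 - B` of some element in its bucket, so all counters
together are at most a sum over the seen elements (`sum_counters_le`), whose mean is `O(1/ε²)`. A
fourth moment bound gives failure probability `ε^4` (`bitProb_sum_lsb_le`). For the doubly
exponential tail let `E = exp(c * lam)`. If `E ≤ 4 log(1/ε)`, the bound `ε^4` is already good
enough. Otherwise some counter has more than about `lam / 2 ^ (a + 2)` bits; its value is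
exponential in `lam`, and a union bound over the elements makes such an `lsb` doubly exponentially
unlikely, with room for the factor `1/ε²`.

Monotonicity. While `F0` at most doubles, `B` rises by a bounded amount, so each counter loses a
bounded number of bits (`space_le_space_add`); this is deterministic.

Hash families are random polynomials of degree less than `k` over a field of characteristic 2
(`exists_kWiseIndependent`). -/

theorem bitProb_eq_expect {r : ℕ} (E : Set (Fin r → Bool)) :
    bitProb E = 𝔼 ω, E.indicator (1 : (Fin r → Bool) → ℝ) ω := by
  classical
  rw [Fintype.expect_eq_sum_div_card, Finset.sum_indicator_eq_sum_filter, bitProb,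
    Set.ncard_eq_toFinset_card']
  simp [Set.toFinset]

theorem expect_ite_eq_bitProb {r : ℕ} (p : (Fin r → Bool) → Prop) [DecidablePred p] :
    𝔼 ω, (if p ω then (1 : ℝ) else 0) = bitProb {ω | p ω} := by
  rw [bitProb_eq_expect]
  refine expect_congr rfl fun ω _ => ?_
  by_cases h : p ω <;> simp [h]

theorem bitProb_mono {r : ℕ} {E E' : Set (Fin r → Bool)} (h : E ⊆ E') :
    bitProb E ≤ bitProb E' := by
  rw [bitProb_eq_expect, bitProb_eq_expect]
  refine expect_le_expect fun ω _ => ?_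
  exact Set.indicator_le_indicator_of_subset h (fun _ => zero_le_one) ω

theorem bitProb_union_le {r : ℕ} (E E' : Set (Fin r → Bool)) :
    bitProb (E ∪ E') ≤ bitProb E + bitProb E' := by
  rw [bitProb_eq_expect, bitProb_eq_expect, bitProb_eq_expect, ← expect_add_distrib]
  refine expect_le_expect fun ω _ => ?_
  by_cases h : ω ∈ E <;> by_cases h' : ω ∈ E' <;> simp [h, h']

theorem bitProb_univ (r : ℕ) : bitProb (Set.univ : Set (Fin r → Bool)) = 1 := by
  rw [bitProb_eq_expect]
  simp

theorem bitProb_compl {r : ℕ} (E : Set (Fin r → Bool)) : bitProb Eᶜ = 1 - bitProb E := by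
  have h : bitProb Eᶜ + bitProb E = 1 := by
    rw [bitProb_eq_expect, bitProb_eq_expect, ← expect_add_distrib]
    have : ∀ ω, Eᶜ.indicator (1 : (Fin r → Bool) → ℝ) ω + E.indicator 1 ω = 1 := by
      intro ω
      by_cases h : ω ∈ E <;> simp [h]
    simp [this]
  linarith

theorem bitProb_biUnion_le {r : ℕ} {ι : Type*} (s : Finset ι) (E : ι → Set (Fin r → Bool)) :
    bitProb {ω | ∃ i ∈ s, ω ∈ E i} ≤ ∑ i ∈ s, bitProb (E i) := by
  classical
  induction s using Finset.induction_on with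
  | empty => simp [bitProb]
  | insert i s hi ih =>
    rw [sum_insert hi]
    refine le_trans (bitProb_mono ?_) ((bitProb_union_le (E i) _).trans (by gcongr))
    rintro ω ⟨j, hj, hω⟩
    rcases Finset.mem_insert.1 hj with rfl | hj
    · exact Or.inl hω
    · exact Or.inr ⟨j, hj, hω⟩

theorem bitProb_markov {r : ℕ} (X : (Fin r → Bool) → ℝ) (hX : ∀ ω, 0 ≤ X ω) {τ : ℝ}
    (hτ : 0 < τ) : bitProb {ω | τ ≤ X ω} ≤ (𝔼 ω, X ω) / τ := by
  rw [bitProb_eq_expect, expect_div]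
  refine expect_le_expect fun ω _ => ?_
  by_cases h : τ ≤ X ω
  · simpa [h] using (one_le_div hτ).2 h
  · simpa [h] using div_nonneg (hX ω) hτ.le

theorem bitProb_append {r s : ℕ} (E : Set (Fin (r + s) → Bool)) :
    bitProb E = 𝔼 u : Fin r → Bool, bitProb {v : Fin s → Bool | Fin.append u v ∈ E} := by
  rw [bitProb_eq_expect,
    ← Fintype.expect_equiv (Fin.appendEquiv (α := Bool) r s)
      (fun w => E.indicator (1 : (Fin (r + s) → Bool) → ℝ) (Fin.append w.1 w.2)) _ (fun w => rfl),
    ← univ_product_univ, expect_product]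
  refine expect_congr rfl fun u _ => ?_
  rw [bitProb_eq_expect]
  rfl

theorem bitProb_append' {r s : ℕ} (E : Set (Fin (r + s) → Bool)) :
    bitProb E = 𝔼 v : Fin s → Bool, bitProb {u : Fin r → Bool | Fin.append u v ∈ E} := by
  rw [bitProb_append]
  simp_rw [bitProb_eq_expect]
  exact expect_comm _ _ _

/-- Fubini over the two blocks. With its mirror image below, this is how the mutual independence of
the three hash functions enters: all blocks but one are frozen. -/
theorem bitProb_le_of_forall_left {r s : ℕ} {E : Set (Fin (r + s) → Bool)} {δ : ℝ}
    (h : ∀ u : Fin r → Bool, bitProb {v : Fin s → Bool | Fin.append u v ∈ E} ≤ δ) :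
    bitProb E ≤ δ := by
  rw [bitProb_append]
  exact expect_le univ_nonempty fun u _ => h u

theorem bitProb_le_of_forall_right {r s : ℕ} {E : Set (Fin (r + s) → Bool)} {δ : ℝ}
    (h : ∀ v : Fin s → Bool, bitProb {u : Fin r → Bool | Fin.append u v ∈ E} ≤ δ) :
    bitProb E ≤ δ := by
  rw [bitProb_append']
  exact expect_le univ_nonempty fun u _ => h u

/-! Moments under limited independence. -/

namespace KWiseIndependent

variable {r k : ℕ} {α β : Type} [Fintype β] {h : (Fin r → Bool) → α → β}

theorem mono {l : ℕ} (hh : KWiseIndependent k h) (hl : l ≤ k) : KWiseIndependent l h :=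
  fun A hA y => hh A (hA.trans hl) y

theorem bitProb_inter [DecidableEq α] (hh : KWiseIndependent k h) {A : Finset α} {s : α}
    (hs : s ∉ A) (hA : A.card + 1 ≤ k) (y : α → β) (v : β) :
    bitProb {ω | (∀ a ∈ A, h ω a = y a) ∧ h ω s = v}
      = bitProb {ω | ∀ a ∈ A, h ω a = y a} * (Fintype.card β : ℝ)⁻¹ := by
  have h1 := hh A (by omega) y
  have h2 := hh (insert s A) (by rw [card_insert_of_notMem hs]; exact hA) (Function.update y s v)
  rw [h1, ← pow_succ, ← card_insert_of_notMem hs, ← h2]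
  congr 1
  ext ω
  simp only [Set.mem_ofPred_eq, mem_insert, forall_eq_or_imp, Function.update_self]
  rw [and_comm]
  refine and_congr_right fun _ => forall₂_congr fun a ha => ?_
  rw [Function.update_of_ne (ne_of_mem_of_not_mem ha hs)]

/-- A function of the values on `A` is independent of the value at another point. -/
theorem expect_mul [DecidableEq α] [DecidableEq β] (hh : KWiseIndependent k h) {A : Finset α}
    {s : α} (hs : s ∉ A) (hA : A.card + 1 ≤ k) (G : (α → β) → ℝ)
    (hG : ∀ f g : α → β, (∀ a ∈ A, f a = g a) → G f = G g) (w : β → ℝ) :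
    𝔼 ω, G (h ω) * w (h ω s) = (𝔼 ω, G (h ω)) * 𝔼 v, w v := by
  classical
  let ω₀ : Fin r → Bool := fun _ => false
  -- Off `A` any value will do, since `G` reads only `A`; `h ω₀` supplies one.
  let ext : (A → β) → α → β := fun y a => if ha : a ∈ A then y ⟨a, ha⟩ else h ω₀ a
  have key : ∀ ω, G (h ω) =
      ∑ y : A → β, G (ext y) * (if ∀ a ∈ A, h ω a = ext y a then (1 : ℝ) else 0) := by
    intro ω
    rw [Finset.sum_eq_single (fun a : A => h ω a)]
    · have : ∀ a ∈ A, h ω a = ext (fun a : A => h ω a) a := fun a ha => by simp [ext, ha]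
      rw [if_pos this, mul_one]
      exact hG _ _ this
    · intro y _ hy
      rw [if_neg, mul_zero]
      intro hc
      apply hy
      funext a
      rw [hc a a.2]
      simp [ext]
    · simp
  have e1 : 𝔼 ω, G (h ω) = ∑ y : A → β, G (ext y) * bitProb {ω | ∀ a ∈ A, h ω a = ext y a} := by
    simp_rw [key]
    rw [expect_sum_comm]
    refine sum_congr rfl fun y _ => ?_
    rw [← mul_expect, expect_ite_eq_bitProb]
  have wkey : ∀ ω, w (h ω s) = ∑ v, w v * (if h ω s = v then (1 : ℝ) else 0) := by
    intro ω
    simp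
  calc 𝔼 ω, G (h ω) * w (h ω s)
      = 𝔼 ω, ∑ y : A → β, ∑ v, G (ext y) * w v *
          (if (∀ a ∈ A, h ω a = ext y a) ∧ h ω s = v then (1 : ℝ) else 0) := by
        refine expect_congr rfl fun ω _ => ?_
        rw [key, wkey, sum_mul_sum]
        refine sum_congr rfl fun y _ => sum_congr rfl fun v _ => ?_
        by_cases h1 : ∀ a ∈ A, h ω a = ext y a <;> by_cases h2 : h ω s = v <;> simp [h1, h2]
    _ = ∑ y : A → β, ∑ v, G (ext y) * w v *
          (bitProb {ω | ∀ a ∈ A, h ω a = ext y a} * (Fintype.card β : ℝ)⁻¹) := by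
        rw [expect_sum_comm]
        refine sum_congr rfl fun y _ => ?_
        rw [expect_sum_comm]
        refine sum_congr rfl fun v _ => ?_
        rw [← mul_expect, expect_ite_eq_bitProb, hh.bitProb_inter hs hA]
    _ = _ := by
        rw [e1, Fintype.expect_eq_sum_div_card, div_eq_mul_inv, ← mul_assoc, sum_mul_sum, sum_mul]
        refine sum_congr rfl fun y _ => ?_
        rw [sum_mul]
        refine sum_congr rfl fun v _ => ?_
        ring

theorem expect_apply [DecidableEq α] [DecidableEq β] (hh : KWiseIndependent k h) (hk : 1 ≤ k)
    (s : α) (w : β → ℝ) : 𝔼 ω, w (h ω s) = 𝔼 v, w v := by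
  have := hh.expect_mul (A := ∅) (s := s) (by simp) (by simpa using hk) (fun _ => 1)
    (fun _ _ _ => rfl) w
  simpa using this

theorem expect_prod [DecidableEq α] [DecidableEq β] (hh : KWiseIndependent k h) (B : Finset α)
    (hB : B.card ≤ k) (w : β → ℝ) :
    𝔼 ω, ∏ b ∈ B, w (h ω b) = (𝔼 v, w v) ^ B.card := by
  induction B using Finset.induction_on with
  | empty => simp
  | insert s B hs ih =>
    rw [card_insert_of_notMem hs] at hB ⊢
    rw [pow_succ, ← ih (by omega), ← hh.expect_mul hs hB (fun f => ∏ b ∈ B, w (f b))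
      (fun f g hfg => prod_congr rfl fun b hb => by rw [hfg b hb])]
    refine expect_congr rfl fun ω _ => ?_
    rw [prod_insert hs, mul_comm]

theorem expect_sum_sq [DecidableEq α] [DecidableEq β] (hh : KWiseIndependent k h) (hk : 2 ≤ k)
    (A : Finset α) (g : β → ℝ) (hg : 𝔼 v, g v = 0) :
    𝔼 ω, (∑ a ∈ A, g (h ω a)) ^ 2 = A.card * 𝔼 v, g v ^ 2 := by
  induction A using Finset.induction_on with
  | empty => simp
  | insert s A hs ih =>
    have h1 : 𝔼 ω, (∑ a ∈ A, g (h ω a)) * g (h ω s) = 0 := by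
      simp_rw [sum_mul]
      rw [expect_sum_comm]
      refine sum_eq_zero fun a ha => ?_
      rw [hh.expect_mul (A := {a}) (by simpa using fun h : s = a => hs (h ▸ ha)) (by simpa using hk)
        (fun f => g (f a)) (fun f f' hf => by rw [hf a (by simp)]), hg, mul_zero]
    have h2 := hh.expect_apply (by omega) s (fun v => g v ^ 2)
    calc 𝔼 ω, (∑ a ∈ insert s A, g (h ω a)) ^ 2
        = 𝔼 ω, ((∑ a ∈ A, g (h ω a)) ^ 2 + 2 * ((∑ a ∈ A, g (h ω a)) * g (h ω s))
            + g (h ω s) ^ 2) := by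
          refine expect_congr rfl fun ω _ => ?_
          rw [sum_insert hs]
          ring
      _ = _ := by
          rw [expect_add_distrib, expect_add_distrib, ← mul_expect, ih, h1, h2,
            card_insert_of_notMem hs]
          push_cast
          ring

/-- Adding one point `s` to a centred sum, the terms of degree 1 and 3 in `g (h ω s)` have mean
zero. The middle term contributes `6 N v²` with `v` the variance, which the increment `(6 N + 3) v²`
of `3 (N v)²` absorbs. -/
theorem expect_sum_pow_four [DecidableEq α] [DecidableEq β] (hh : KWiseIndependent k h)
    (hk : 4 ≤ k) (A : Finset α) (g : β → ℝ) (hg : 𝔼 v, g v = 0) :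
    𝔼 ω, (∑ a ∈ A, g (h ω a)) ^ 4
      ≤ 3 * (A.card * 𝔼 v, g v ^ 2) ^ 2 + A.card * 𝔼 v, g v ^ 4 := by
  induction A using Finset.induction_on with
  | empty => simp
  | insert s A hs ih =>
    have h1 : 𝔼 ω, (∑ a ∈ A, g (h ω a)) ^ 3 * g (h ω s) = 0 := by
      have : ∀ ω, (∑ a ∈ A, g (h ω a)) ^ 3 * g (h ω s) =
          ∑ a ∈ A, ∑ b ∈ A, ∑ c ∈ A, (g (h ω a) * g (h ω b) * g (h ω c)) * g (h ω s) := by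
        intro ω
        rw [pow_succ, pow_two, sum_mul_sum, sum_mul, sum_mul]
        refine sum_congr rfl fun a _ => ?_
        rw [sum_mul_sum, sum_mul]
        refine sum_congr rfl fun b _ => ?_
        rw [sum_mul]
      simp_rw [this]
      rw [expect_sum_comm]
      refine sum_eq_zero fun a ha => ?_
      rw [expect_sum_comm]
      refine sum_eq_zero fun b hb => ?_
      rw [expect_sum_comm]
      refine sum_eq_zero fun c hc => ?_
      have hsub : ({a, b, c} : Finset α) ⊆ A := by
        intro z
        simp only [mem_insert, mem_singleton]
        rintro (rfl | rfl | rfl) <;> assumption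
      rw [hh.expect_mul (A := {a, b, c}) (fun h => hs (hsub h))
        (le_trans (Nat.add_le_add_right card_le_three 1) hk)
        (fun f => g (f a) * g (f b) * g (f c))
        (fun f f' hf => by rw [hf a (by simp), hf b (by simp), hf c (by simp)]), hg, mul_zero]
    have h2 : 𝔼 ω, (∑ a ∈ A, g (h ω a)) ^ 2 * g (h ω s) ^ 2
        = (A.card * 𝔼 v, g v ^ 2) * 𝔼 v, g v ^ 2 := by
      rw [← hh.expect_sum_sq (by omega) A g hg, Finset.expect_mul]
      have : ∀ ω, (∑ a ∈ A, g (h ω a)) ^ 2 = ∑ a ∈ A, ∑ b ∈ A, g (h ω a) * g (h ω b) := by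
        intro ω
        rw [pow_two, sum_mul_sum]
      simp_rw [this, sum_mul]
      rw [expect_sum_comm, expect_sum_comm]
      refine sum_congr rfl fun a ha => ?_
      rw [expect_sum_comm, expect_sum_comm]
      refine sum_congr rfl fun b hb => ?_
      have hsub : ({a, b} : Finset α) ⊆ A := by
        intro z
        simp only [mem_insert, mem_singleton]
        rintro (rfl | rfl) <;> assumption
      rw [hh.expect_mul (A := {a, b}) (fun h => hs (hsub h))
        (le_trans (Nat.add_le_add_right card_le_two 1) (by omega))
        (fun f => g (f a) * g (f b))
        (fun f f' hf => by rw [hf a (by simp), hf b (by simp)]) (fun v => g v ^ 2),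
        ← Finset.expect_mul]
    have h3 : 𝔼 ω, (∑ a ∈ A, g (h ω a)) * g (h ω s) ^ 3 = 0 := by
      simp_rw [sum_mul]
      rw [expect_sum_comm]
      refine sum_eq_zero fun a ha => ?_
      rw [hh.expect_mul (A := {a}) (by simpa using fun h : s = a => hs (h ▸ ha))
        (by rw [card_singleton]; omega)
        (fun f => g (f a)) (fun f f' hf => by rw [hf a (by simp)]) (fun v => g v ^ 3),
        hh.expect_apply (by omega), hg, zero_mul]
    have h4 := hh.expect_apply (by omega) s (fun v => g v ^ 4)
    have hv : 0 ≤ 𝔼 v, g v ^ 2 := expect_nonneg fun v _ => sq_nonneg _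
    calc 𝔼 ω, (∑ a ∈ insert s A, g (h ω a)) ^ 4
        = 𝔼 ω, ((∑ a ∈ A, g (h ω a)) ^ 4 + 4 * ((∑ a ∈ A, g (h ω a)) ^ 3 * g (h ω s))
            + 6 * ((∑ a ∈ A, g (h ω a)) ^ 2 * g (h ω s) ^ 2)
            + 4 * ((∑ a ∈ A, g (h ω a)) * g (h ω s) ^ 3) + g (h ω s) ^ 4) := by
          refine expect_congr rfl fun ω _ => ?_
          rw [sum_insert hs]
          ring
      _ ≤ _ := by
          rw [expect_add_distrib, expect_add_distrib, expect_add_distrib, expect_add_distrib,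
            ← mul_expect, ← mul_expect, ← mul_expect, h1, h2, h3, h4, card_insert_of_notMem hs]
          push_cast
          nlinarith [ih, sq_nonneg (𝔼 v, g v ^ 2)]

/-- Chebyshev's inequality for a sum of pairwise independent variables. -/
theorem bitProb_abs_sub_le [DecidableEq α] [DecidableEq β] [Nonempty β]
    (hh : KWiseIndependent k h) (hk : 2 ≤ k)
    (A : Finset α) (w : β → ℝ) {τ : ℝ} (hτ : 0 < τ) :
    bitProb {ω | τ ≤ |∑ a ∈ A, w (h ω a) - A.card * 𝔼 v, w v|}
      ≤ A.card * (𝔼 v, w v ^ 2) / τ ^ 2 := by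
  set μ := 𝔼 v, w v with hμ
  have hg : 𝔼 v, (w v - μ) = 0 := by
    rw [expect_sub_distrib, Fintype.expect_const, sub_self]
  have hsum : ∀ ω, ∑ a ∈ A, w (h ω a) - A.card * μ = ∑ a ∈ A, (w (h ω a) - μ) := by
    intro ω
    simp [sum_sub_distrib]
  have hvar : 𝔼 v, (w v - μ) ^ 2 ≤ 𝔼 v, w v ^ 2 := by
    have : ∀ v, (w v - μ) ^ 2 = w v ^ 2 - (2 * μ) * w v + μ ^ 2 := fun v => by ring
    simp_rw [this]
    rw [expect_add_distrib, expect_sub_distrib, ← mul_expect, Fintype.expect_const, ← hμ]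
    nlinarith [sq_nonneg μ]
  refine le_trans (bitProb_mono ?_) ((bitProb_markov
    (fun ω => (∑ a ∈ A, (w (h ω a) - μ)) ^ 2) (fun ω => sq_nonneg _) (pow_pos hτ 2)).trans ?_)
  · intro ω hω
    simp only [Set.mem_ofPred_eq, hsum] at hω ⊢
    rw [← sq_abs (∑ a ∈ A, (w (h ω a) - μ))]
    gcongr
  · rw [hh.expect_sum_sq hk A _ hg]
    gcongr

/-- A fourth moment bound for the upper tail of a sum of 4-wise independent variables. -/
theorem bitProb_add_le [DecidableEq α] [DecidableEq β] [Nonempty β]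
    (hh : KWiseIndependent k h) (hk : 4 ≤ k)
    (A : Finset α) (w : β → ℝ) (hw : ∀ v, 0 ≤ w v) {τ : ℝ} (hτ : 0 < τ) :
    bitProb {ω | A.card * (𝔼 v, w v) + τ ≤ ∑ a ∈ A, w (h ω a)}
      ≤ (3 * (A.card * 𝔼 v, w v ^ 2) ^ 2 + A.card * ((𝔼 v, w v ^ 4) + (𝔼 v, w v) ^ 4)) / τ ^ 4 := by
  set μ := 𝔼 v, w v with hμ
  have hμ0 : 0 ≤ μ := expect_nonneg fun v _ => hw v
  have hg : 𝔼 v, (w v - μ) = 0 := by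
    rw [expect_sub_distrib, Fintype.expect_const, sub_self]
  have hsum : ∀ ω, ∑ a ∈ A, (w (h ω a) - μ) = ∑ a ∈ A, w (h ω a) - A.card * μ := by
    intro ω
    simp [sum_sub_distrib]
  have hvar : 𝔼 v, (w v - μ) ^ 2 ≤ 𝔼 v, w v ^ 2 := by
    have : ∀ v, (w v - μ) ^ 2 = w v ^ 2 - (2 * μ) * w v + μ ^ 2 := fun v => by ring
    simp_rw [this]
    rw [expect_add_distrib, expect_sub_distrib, ← mul_expect, Fintype.expect_const, ← hμ]
    nlinarith [sq_nonneg μ]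
  have hfour : 𝔼 v, (w v - μ) ^ 4 ≤ (𝔼 v, w v ^ 4) + μ ^ 4 := by
    rw [← Fintype.expect_const (ι := β) (μ ^ 4), ← expect_add_distrib]
    refine expect_le_expect fun v _ => ?_
    have h0 := hw v
    rcases le_total μ (w v) with hc | hc
    · have : (w v - μ) ^ 4 ≤ w v ^ 4 := pow_le_pow_left₀ (by linarith) (by linarith) 4
      nlinarith [pow_nonneg hμ0 4]
    · have : (w v - μ) ^ 4 ≤ μ ^ 4 := by
        rw [← neg_sub, Even.neg_pow (by decide)]
        exact pow_le_pow_left₀ (by linarith) (by linarith) 4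
      nlinarith [pow_nonneg h0 4]
  refine le_trans (bitProb_mono ?_) ((bitProb_markov
    (fun ω => (∑ a ∈ A, (w (h ω a) - μ)) ^ 4) (fun ω => by positivity) (pow_pos hτ 4)).trans ?_)
  · intro ω hω
    simp only [Set.mem_ofPred_eq, hsum] at hω ⊢
    exact pow_le_pow_left₀ hτ.le (by linarith) 4
  · gcongr
    refine (hh.expect_sum_pow_four hk A _ hg).trans ?_
    have : 0 ≤ 𝔼 v, (w v - μ) ^ 2 := expect_nonneg fun v _ => sq_nonneg _
    gcongr

end KWiseIndependent

/-! Empty bins under limited independence. -/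

/-- By Pascal's rule the truncation error at `(N + 1, k + 1)` is the error at `(N, k + 1)` minus `x`
times that at `(N, k)`, and the bound obeys the same recursion with a plus sign. The case `x = 1` is
Bonferroni's inequality. -/
theorem abs_sum_range_choose_sub_le {x : ℝ} (h0 : 0 ≤ x) (h1 : x ≤ 1) (N k : ℕ) :
    |∑ j ∈ range k, (-1) ^ j * (N.choose j : ℝ) * x ^ j - (1 - x) ^ N| ≤ N.choose k * x ^ k := by
  induction N generalizing k with
  | zero =>
    cases k with
    | zero => simp
    | succ k =>
      rw [sum_range_succ']
      simp
  | succ N ih =>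
    cases k with
    | zero =>
      simp only [range_zero, sum_empty, zero_sub, abs_neg, Nat.choose_zero_right, Nat.cast_one,
        pow_zero, mul_one]
      rw [abs_of_nonneg (pow_nonneg (by linarith) _)]
      exact pow_le_one₀ (by linarith) (by linarith)
    | succ k =>
      have e : ∑ j ∈ range (k + 1), (-1) ^ j * ((N + 1).choose j : ℝ) * x ^ j - (1 - x) ^ (N + 1)
          = (∑ j ∈ range (k + 1), (-1) ^ j * (N.choose j : ℝ) * x ^ j - (1 - x) ^ N)
            - x * (∑ j ∈ range k, (-1) ^ j * (N.choose j : ℝ) * x ^ j - (1 - x) ^ N) := by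
        have : ∀ j, (-1) ^ (j + 1) * ((N + 1).choose (j + 1) : ℝ) * x ^ (j + 1)
            = (-1) ^ (j + 1) * (N.choose (j + 1) : ℝ) * x ^ (j + 1)
              - x * ((-1) ^ j * (N.choose j : ℝ) * x ^ j) := by
          intro j
          rw [Nat.choose_succ_succ]
          push_cast
          ring
        rw [sum_range_succ', sum_range_succ' (fun j => (-1) ^ j * (N.choose j : ℝ) * x ^ j) k]
        simp_rw [this]
        rw [sum_sub_distrib, ← mul_sum]
        simp only [Nat.choose_zero_right]
        ring
      rw [e]
      refine (abs_sub _ _).trans ?_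
      rw [abs_mul, abs_of_nonneg h0]
      calc _ ≤ N.choose (k + 1) * x ^ (k + 1) + x * (N.choose k * x ^ k) :=
            add_le_add (ih _) (mul_le_mul_of_nonneg_left (ih _) h0)
        _ = _ := by
            rw [Nat.choose_succ_succ]
            push_cast
            ring

/-- Binomial moments count `j`-subsets, so limited independence determines them exactly for `j ≤ k`.
-/
theorem choose_card_filter_eq_sum {α : Type*} [DecidableEq α] (A : Finset α) (p : α → Prop)
    [DecidablePred p] (j : ℕ) :
    (((A.filter p).card.choose j : ℕ) : ℝ)
      = ∑ B ∈ A.powersetCard j, ∏ b ∈ B, if p b then (1 : ℝ) else 0 := by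
  have : ∀ B : Finset α, (∏ b ∈ B, if p b then (1 : ℝ) else 0)
      = if ∀ b ∈ B, p b then (1 : ℝ) else 0 := by
    intro B
    exact prod_ite_zero.trans (by simp)
  simp_rw [this]
  rw [sum_boole, ← card_powersetCard]
  congr 2
  ext B
  simp only [mem_powersetCard, mem_filter, subset_iff]
  constructor
  · rintro ⟨h1, h2⟩
    exact ⟨⟨fun b hb => (h1 hb).1, h2⟩, fun b hb => (h1 hb).2⟩
  · rintro ⟨⟨h1, h2⟩, h3⟩
    exact ⟨fun b hb => ⟨h1 hb, h3 b hb⟩, h2⟩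

namespace KWiseIndependent

variable {r k : ℕ} {α β : Type} [Fintype β] {h : (Fin r → Bool) → α → β}

theorem expect_choose [DecidableEq α] [DecidableEq β] (hh : KWiseIndependent k h) (A : Finset α)
    (J : Finset β) {j : ℕ} (hj : j ≤ k) :
    𝔼 ω, (((A.filter fun a => h ω a ∈ J).card.choose j : ℕ) : ℝ)
      = A.card.choose j * ((J.card : ℝ) / Fintype.card β) ^ j := by
  simp_rw [choose_card_filter_eq_sum]
  rw [expect_sum_comm]
  have hJ : 𝔼 v : β, (if v ∈ J then (1 : ℝ) else 0) = (J.card : ℝ) / Fintype.card β := by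
    rw [Fintype.expect_eq_sum_div_card]
    simp
  calc _ = ∑ B ∈ A.powersetCard j, ((J.card : ℝ) / Fintype.card β) ^ j := by
        refine sum_congr rfl fun B hB => ?_
        rw [mem_powersetCard] at hB
        rw [hh.expect_prod B (hB.2.trans_le hj) (fun v => if v ∈ J then (1 : ℝ) else 0), hJ, hB.2]
    _ = _ := by simp

/-- With `k`-wise independence, the probability that no point of `A` falls into `J` is close to its
value for independent points. -/
theorem abs_bitProb_forall_notMem_sub_le [DecidableEq α] [DecidableEq β]
    (hh : KWiseIndependent k h) (A : Finset α) (J : Finset β) :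
    |bitProb {ω | ∀ a ∈ A, h ω a ∉ J} - (1 - (J.card : ℝ) / Fintype.card β) ^ A.card|
      ≤ 2 * (A.card.choose k * ((J.card : ℝ) / Fintype.card β) ^ k) := by
  set x : ℝ := (J.card : ℝ) / Fintype.card β with hx
  have hx0 : 0 ≤ x := by positivity
  have hx1 : x ≤ 1 := div_le_one_of_le₀ (by exact_mod_cast card_le_univ J) (by positivity)
  let L : (Fin r → Bool) → ℕ := fun ω => (A.filter fun a => h ω a ∈ J).card
  -- The truncated sum is the pivot: it is close to the value for independent points, and, being a
  -- combination of binomial moments, also to the true probability.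
  let S : ℝ := ∑ j ∈ range k, (-1) ^ j * (A.card.choose j : ℝ) * x ^ j
  have h1 : |S - (1 - x) ^ A.card| ≤ A.card.choose k * x ^ k :=
    abs_sum_range_choose_sub_le hx0 hx1 _ _
  have hS : S = 𝔼 ω, ∑ j ∈ range k, (-1) ^ j * ((L ω).choose j : ℝ) := by
    rw [expect_sum_comm]
    refine sum_congr rfl fun j hj => ?_
    rw [← mul_expect, hh.expect_choose A J (mem_range.1 hj).le]
    ring
  -- The indicator of `L = 0` is `(1 - 1) ^ L`, so the truncation lemma applies pointwise with `x =
  -- 1`.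
  have hp : bitProb {ω | ∀ a ∈ A, h ω a ∉ J} = 𝔼 ω, (0 : ℝ) ^ L ω := by
    rw [← expect_ite_eq_bitProb]
    refine expect_congr rfl fun ω _ => ?_
    have : L ω = 0 ↔ ∀ a ∈ A, h ω a ∉ J := by
      simp [L, filter_eq_empty_iff]
    rw [zero_pow_eq, if_congr this rfl rfl]
  have h2 : |S - bitProb {ω | ∀ a ∈ A, h ω a ∉ J}| ≤ A.card.choose k * x ^ k := by
    rw [hS, hp, ← expect_sub_distrib, ← hh.expect_choose A J le_rfl]
    refine (abs_expect_le _ _).trans (expect_le_expect fun ω _ => ?_)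
    simpa using abs_sum_range_choose_sub_le zero_le_one le_rfl (L ω) k
  rw [abs_le] at h1 h2 ⊢
  constructor <;> linarith [h1.1, h1.2, h2.1, h2.2]

end KWiseIndependent

/-- The number of bins that receive no point of `A`. -/
def emptyBins {α β : Type} [Fintype β] [DecidableEq β] (A : Finset α) (g : α → β) : ℕ :=
  (univ.filter fun i => ∀ a ∈ A, g a ∉ ({i} : Finset β)).card

/-- The left side is the variance of the number of empty bins for independent balls. For `N > 0` it
is `P (q1 - q2) - P² (q3 - q2)`, where the first term is at most `N` and the second at least `N q2`;
what remains is `N (1 - q2) ≤ 2 N² / P`. -/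
theorem variance_bound {P : ℝ} (hP : 2 ≤ P) (N : ℕ) :
    P * (1 - 1 / P) ^ N + P * (P - 1) * (1 - 2 / P) ^ N - P ^ 2 * ((1 - 1 / P) ^ N) ^ 2
      ≤ 2 * N ^ 2 / P := by
  have hP0 : 0 < P := by linarith
  cases N with
  | zero =>
    simp
    nlinarith
  | succ N =>
    set y := 1 / P with hy
    have hy0 : 0 < y := by positivity
    have hy2 : y ≤ 1 / 2 := by
      rw [hy]
      gcongr
    have h2y : 2 / P = 2 * y := by rw [hy]; ring
    have hPy : P * y = 1 := by rw [hy]; field_simp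
    rw [h2y]
    have hb : ((1 - y) ^ (N + 1)) ^ 2 = (1 - 2 * y + y ^ 2) ^ (N + 1) := by
      rw [← pow_mul, mul_comm, pow_mul]
      congr 1
      ring
    rw [hb]
    set q1 := (1 - y) ^ (N + 1)
    set q2 := (1 - 2 * y) ^ (N + 1)
    set q3 := (1 - 2 * y + y ^ 2) ^ (N + 1)
    have hq2 : 0 ≤ q2 := pow_nonneg (by linarith) _
    -- `q3 - q2 ≥ (N+1) y² q2`
    have h3 : q2 + (N + 1) * y ^ 2 * q2 ≤ q3 := by
      have e : q3 = ∑ m ∈ range (N + 1 + 1), (y ^ 2) ^ m * (1 - 2 * y) ^ (N + 1 - m)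
          * ((N + 1).choose m : ℝ) := by
        rw [← add_pow]
        ring
      have hle : ∑ m ∈ range 2, (y ^ 2) ^ m * (1 - 2 * y) ^ (N + 1 - m) * ((N + 1).choose m : ℝ)
          ≤ q3 := by
        rw [e]
        refine sum_le_sum_of_subset_of_nonneg (range_subset_range.2 (by omega)) fun i _ _ => ?_
        have : 0 ≤ 1 - 2 * y := by linarith
        positivity
      refine le_trans ?_ hle
      simp only [sum_range_succ, range_zero, sum_empty, pow_zero, pow_one, Nat.sub_zero,
        Nat.choose_zero_right, Nat.choose_one_right, Nat.add_sub_cancel]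
      have : q2 ≤ (1 - 2 * y) ^ N := by
        change (1 - 2 * y) ^ (N + 1) ≤ _
        exact pow_le_pow_of_le_one (by linarith) (by linarith) (by omega)
      push_cast
      have h5 : 0 ≤ ((N : ℝ) + 1) * y ^ 2 := by positivity
      nlinarith
    -- `q1 - q2 ≤ (N+1) y`
    have h4 : q1 - q2 ≤ (N + 1) * y := by
      have hg := (Commute.all (1 - y) (1 - 2 * y)).geom_sum₂_mul (N + 1)
      have hs : ∑ i ∈ range (N + 1), (1 - y) ^ i * (1 - 2 * y) ^ (N + 1 - 1 - i) ≤ N + 1 := by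
        refine (sum_le_sum (g := fun _ => (1 : ℝ)) fun i _ => ?_).trans (by simp)
        exact mul_le_one₀ (pow_le_one₀ (by linarith) (by linarith)) (pow_nonneg (by linarith) _)
          (pow_le_one₀ (by linarith) (by linarith))
      calc q1 - q2 = _ := hg.symm
        _ ≤ (N + 1) * ((1 - y) - (1 - 2 * y)) := by gcongr; linarith
        _ = _ := by ring
    -- `1 - q2 ≤ 2 (N+1) y`
    have h6 : 1 - 2 * ((N + 1) * y) ≤ q2 := by
      have := one_add_mul_le_pow (a := -(2 * y)) (by linarith) (N + 1)
      push_cast at this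
      calc _ = 1 + ((N : ℝ) + 1) * -(2 * y) := by ring
        _ ≤ _ := this
        _ = q2 := by simp only [q2]; ring
    push_cast
    have e1 : P * q1 + P * (P - 1) * q2 - P ^ 2 * q3
        = P * (q1 - q2) - P ^ 2 * (q3 - q2) := by ring
    have e2 : P * (q1 - q2) ≤ N + 1 := by
      calc P * (q1 - q2) ≤ P * ((N + 1) * y) := by gcongr
        _ = (N + 1) * (P * y) := by ring
        _ = _ := by rw [hPy, mul_one]
    have e3 : (N + 1) * q2 ≤ P ^ 2 * (q3 - q2) := by
      calc (N + 1) * q2 = P ^ 2 * ((N + 1) * y ^ 2 * q2) := by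
            rw [show P ^ 2 * (((N : ℝ) + 1) * y ^ 2 * q2) = (P * y) ^ 2 * ((N + 1) * q2) by ring,
              hPy]
            ring
        _ ≤ _ := by gcongr; linarith
    have e4 : ((N : ℝ) + 1) * (1 - q2) ≤ (N + 1) * (2 * ((N + 1) * y)) := by gcongr; linarith
    have e5 : ((N : ℝ) + 1) * (2 * ((N + 1) * y)) = 2 * ((N : ℝ) + 1) ^ 2 / P := by
      rw [hy]; ring
    rw [e1]
    linarith

namespace KWiseIndependent

variable {r k : ℕ} {α β : Type} [Fintype β] {h : (Fin r → Bool) → α → β}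

theorem expect_emptyBins_sub_sq_le [DecidableEq α] [DecidableEq β]
    (hh : KWiseIndependent k h) (A : Finset α) (hβ : 2 ≤ Fintype.card β) :
    𝔼 ω, ((emptyBins A (h ω) : ℝ)
        - Fintype.card β * (1 - 1 / (Fintype.card β : ℝ)) ^ A.card) ^ 2
      ≤ 2 * (A.card : ℝ) ^ 2 / Fintype.card β
        + 8 * (Fintype.card β : ℝ) ^ 2 * (A.card.choose k * (2 / (Fintype.card β : ℝ)) ^ k) := by
  set P : ℝ := (Fintype.card β : ℝ) with hP
  have hP2 : 2 ≤ P := by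
    rw [hP]
    exact_mod_cast hβ
  have hP0 : 0 < P := by linarith
  set N := A.card
  set q1 := (1 - 1 / P) ^ N
  set q2 := (1 - 2 / P) ^ N
  set η := 2 * (N.choose k * (2 / P) ^ k) with hη
  have hη0 : 0 ≤ η := by positivity
  have hq1 : 0 ≤ q1 := by
    have : 1 / P ≤ 1 := by rw [div_le_one hP0]; linarith
    exact pow_nonneg (by linarith) _
  let I : (Fin r → Bool) → β → ℝ := fun ω i =>
    if ∀ a ∈ A, h ω a ∉ ({i} : Finset β) then 1 else 0
  have hV : ∀ ω, (emptyBins A (h ω) : ℝ) = ∑ i, I ω i := fun ω => by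
    simp only [emptyBins, I, sum_boole]
  have hone : ∀ i, |𝔼 ω, I ω i - q1| ≤ η := by
    intro i
    have := hh.abs_bitProb_forall_notMem_sub_le A {i}
    rw [card_singleton, Nat.cast_one, ← hP, ← expect_ite_eq_bitProb] at this
    refine this.trans ?_
    rw [hη]
    gcongr
    norm_num
  have htwo : ∀ i j, i ≠ j → |𝔼 ω, I ω i * I ω j - q2| ≤ η := by
    intro i j hij
    have := hh.abs_bitProb_forall_notMem_sub_le A {i, j}
    rw [card_pair hij, Nat.cast_ofNat, ← hP, ← expect_ite_eq_bitProb] at this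
    refine le_trans (le_of_eq ?_) this
    congr 2
    refine expect_congr rfl fun ω _ => ?_
    simp only [I, ← ite_and, mul_ite, mul_one, mul_zero]
    refine if_congr ?_ rfl rfl
    simp only [mem_singleton, mem_insert, not_or]
    constructor
    · rintro ⟨h1, h2⟩ a ha
      exact ⟨h2 a ha, h1 a ha⟩
    · intro h'
      exact ⟨fun a ha => (h' a ha).2, fun a ha => (h' a ha).1⟩
  have hEV : 𝔼 ω, ∑ i, I ω i = ∑ i, 𝔼 ω, I ω i := expect_sum_comm _ _ _
  have hEVlow : P * (q1 - η) ≤ ∑ i, 𝔼 ω, I ω i := by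
    calc P * (q1 - η) = ∑ i : β, (q1 - η) := by rw [sum_const, card_univ, nsmul_eq_mul]
      _ ≤ _ := sum_le_sum fun i _ => by linarith [(abs_le.1 (hone i)).1]
  have hcount : ∀ i : β, ((univ.erase i).card : ℝ) = P - 1 := by
    intro i
    rw [card_erase_of_mem (mem_univ i), card_univ, Nat.cast_sub (by omega), hP, Nat.cast_one]
  have hEV2 : 𝔼 ω, (∑ i, I ω i) ^ 2 ≤ P * (q1 + η) + P * (P - 1) * (q2 + η) := by
    have : ∀ ω, (∑ i, I ω i) ^ 2 = ∑ i, (I ω i + ∑ j ∈ univ.erase i, I ω i * I ω j) := by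
      intro ω
      rw [pow_two, sum_mul_sum]
      refine sum_congr rfl fun i _ => ?_
      rw [← add_sum_erase univ _ (mem_univ i)]
      congr 1
      simp only [I]
      split_ifs <;> simp
    simp_rw [this]
    rw [expect_sum_comm]
    calc _ ≤ ∑ i : β, ((q1 + η) + (P - 1) * (q2 + η)) := by
          refine sum_le_sum fun i _ => ?_
          rw [expect_add_distrib, expect_sum_comm]
          refine add_le_add (by linarith [(abs_le.1 (hone i)).2]) ?_
          calc _ ≤ ∑ j ∈ univ.erase i, (q2 + η) := by
                refine sum_le_sum fun j hj => ?_
                linarith [(abs_le.1 (htwo i j (ne_of_mem_erase hj).symm)).2]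
            _ = _ := by rw [sum_const, nsmul_eq_mul, hcount]
      _ = _ := by
          rw [sum_const, card_univ, nsmul_eq_mul, ← hP]
          ring
  have hexp : 𝔼 ω, ((emptyBins A (h ω) : ℝ) - P * q1) ^ 2
      = 𝔼 ω, (∑ i, I ω i) ^ 2 - 2 * (P * q1) * (∑ i, 𝔼 ω, I ω i) + (P * q1) ^ 2 := by
    rw [← hEV, mul_expect, ← expect_sub_distrib,
      ← Fintype.expect_const (ι := Fin r → Bool) ((P * q1) ^ 2), ← expect_add_distrib]
    refine expect_congr rfl fun ω _ => ?_
    rw [hV]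
    ring
  have hq1' : q1 ≤ 1 := by
    have h1 : 1 / P ≤ 1 := by rw [div_le_one hP0]; linarith
    have h2 : 0 < 1 / P := by positivity
    exact pow_le_one₀ (by linarith) (by linarith)
  rw [hexp]
  have hv := variance_bound hP2 N
  have h1 : 2 * (P * q1) * (P * (q1 - η)) ≤ 2 * (P * q1) * (∑ i, 𝔼 ω, I ω i) := by gcongr
  -- Total cost of limited independence: the diagonal and off-diagonal terms of the second moment,
  -- and the cross term with the mean.
  have h2 : P * η + P * (P - 1) * η + 2 * P ^ 2 * q1 * η ≤ 4 * P ^ 2 * η := by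
    have : q1 * η ≤ 1 * η := by gcongr
    nlinarith [mul_nonneg (sq_nonneg P) hη0, mul_le_mul_of_nonneg_left this (sq_nonneg P)]
  have h3 : 8 * P ^ 2 * (N.choose k * (2 / P) ^ k) = 4 * P ^ 2 * η := by rw [hη]; ring
  rw [h3]
  nlinarith [hv, h1, h2, hEV2]

end KWiseIndependent

/-! The distribution of the least significant bit. -/

/-- The convention `lsb 0 = m` is what makes this hold for `v = 0` as well. -/
theorem le_lsb_iff {m r : ℕ} (hr : r ≤ m) (v : Fin (2 ^ m)) : r ≤ lsb v ↔ 2 ^ r ∣ (v : ℕ) := by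
  unfold lsb
  split_ifs with h
  · simp [h, hr]
  · rw [padicValNat_dvd_iff_le h]

theorem lsb_le {m : ℕ} (v : Fin (2 ^ m)) : lsb v ≤ m := by
  unfold lsb
  split_ifs with h
  · exact le_rfl
  · have h1 : 2 ^ padicValNat 2 (v : ℕ) ∣ (v : ℕ) := pow_padicValNat_dvd
    have h2 := (Nat.le_of_dvd (Nat.pos_of_ne_zero h) h1).trans_lt v.2
    exact ((Nat.pow_lt_pow_iff_right (by norm_num)).1 h2).le

theorem expect_le_lsb {m r : ℕ} (hr : r ≤ m) :
    𝔼 v : Fin (2 ^ m), (if r ≤ lsb v then (1 : ℝ) else 0) = (2 ^ r : ℝ)⁻¹ := by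
  have hcard : (univ.filter fun v : Fin (2 ^ m) => r ≤ lsb v).card = 2 ^ (m - r) := by
    have hm : 2 ^ m = 2 ^ r * 2 ^ (m - r) := by rw [← pow_add, Nat.add_sub_cancel' hr]
    have hlt : ∀ u : Fin (2 ^ (m - r)), 2 ^ r * (u : ℕ) < 2 ^ m := fun u => by
      rw [hm]
      exact Nat.mul_lt_mul_of_pos_left u.2 (by positivity)
    rw [← Fintype.card_fin (2 ^ (m - r)), ← card_univ]
    symm
    refine card_bij (fun u _ => ⟨2 ^ r * (u : ℕ), hlt u⟩) ?_ ?_ ?_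
    · intro u _
      simp [le_lsb_iff hr]
    · intro u _ u' _ h
      simpa [Fin.ext_iff] using h
    · intro v hv
      rw [mem_filter, le_lsb_iff hr] at hv
      obtain ⟨c, hc⟩ := hv.2
      refine ⟨⟨c, ?_⟩, mem_univ _, Fin.ext hc.symm⟩
      have := v.2
      rw [hc, hm] at this
      exact Nat.lt_of_mul_lt_mul_left this
  rw [Fintype.expect_eq_sum_div_card, sum_boole, hcard, Fintype.card_fin]
  push_cast
  rw [div_eq_iff (by positivity), pow_sub₀ _ (by norm_num) hr]
  ring

theorem expect_le_lsb_le (m r : ℕ) :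
    𝔼 v : Fin (2 ^ m), (if r ≤ lsb v then (1 : ℝ) else 0) ≤ (2 ^ r : ℝ)⁻¹ := by
  rcases le_or_gt r m with hr | hr
  · exact (expect_le_lsb hr).le
  · have : ∀ v : Fin (2 ^ m), (if r ≤ lsb v then (1 : ℝ) else 0) = 0 := fun v =>
      if_neg (by have := lsb_le v; omega)
    simp [this]

/-- Any base below 2 would serve: the bound is to be summed against the tail `2⁻ʲ` of `lsb`. Beyond
`j = 10` the induction works because `(11/10)^4 ≤ 3/2`. -/
theorem pow_four_le (j : ℕ) : (j : ℝ) ^ 4 ≤ 256 * (3 / 2 : ℝ) ^ j := by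
  rcases le_or_gt j 10 with hj | hj
  · interval_cases j <;> norm_num
  · induction j, hj.le using Nat.le_induction with
    | base => norm_num
    | succ j hj' ih =>
      have ih' : (j : ℝ) ^ 4 ≤ 256 * (3 / 2 : ℝ) ^ j := by
        rcases hj'.eq_or_lt with h | h
        · subst h
          norm_num
        · exact ih h
      have h10 : (10 : ℝ) ≤ j := by exact_mod_cast hj'
      have h1 : (j : ℝ) + 1 ≤ 11 / 10 * j := by linarith
      calc (((j + 1 : ℕ) : ℝ)) ^ 4 = ((j : ℝ) + 1) ^ 4 := by push_cast; ring
        _ ≤ (11 / 10 * (j : ℝ)) ^ 4 := by gcongr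
        _ = (11 / 10) ^ 4 * (j : ℝ) ^ 4 := by ring
        _ ≤ 3 / 2 * (256 * (3 / 2 : ℝ) ^ j) := by gcongr; norm_num
        _ = _ := by ring

theorem expect_lsb_pow_four_le (m B : ℕ) :
    𝔼 v : Fin (2 ^ m), ((lsb v + 1 - B : ℕ) : ℝ) ^ 4 ≤ 1536 * (2 ^ B : ℝ)⁻¹ := by
  -- Layer-cake form: the geometric sum up to `X` equals `768 ((3/2)^X - 1)`, which is at least `256
  -- (3/2)^X` as soon as `X ≥ 1`.
  have key : ∀ v : Fin (2 ^ m), ((lsb v + 1 - B : ℕ) : ℝ) ^ 4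
      ≤ ∑ j ∈ range (m + 1), 384 * (3 / 2 : ℝ) ^ j * (if B + j ≤ lsb v then (1 : ℝ) else 0) := by
    intro v
    set X := lsb v + 1 - B with hX
    have hXm : X ≤ m + 1 := by have := lsb_le v; omega
    have e : ∑ j ∈ range (m + 1), 384 * (3 / 2 : ℝ) ^ j * (if B + j ≤ lsb v then (1 : ℝ) else 0)
        = ∑ j ∈ range X, 384 * (3 / 2 : ℝ) ^ j := by
      rw [← sum_subset (range_subset_range.2 hXm)]
      · refine sum_congr rfl fun j hj => ?_
        rw [mem_range] at hj
        rw [if_pos (by omega), mul_one]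
      · intro j _ hj
        rw [mem_range] at hj
        rw [if_neg (by omega), mul_zero]
    rw [e, ← mul_sum, geom_sum_eq (by norm_num)]
    rcases Nat.eq_zero_or_pos X with h0 | h0
    · simp [h0]
    · have h1 := pow_four_le X
      rw [show (3 / 2 - 1 : ℝ) = 1 / 2 by norm_num]
      have h2 : (3 / 2 : ℝ) ^ 1 ≤ (3 / 2) ^ X := pow_le_pow_right₀ (by norm_num) h0
      linarith
  refine (expect_le_expect fun v _ => key v).trans ?_
  rw [expect_sum_comm]
  calc _ ≤ ∑ j ∈ range (m + 1), 384 * (3 / 2 : ℝ) ^ j * (2 ^ (B + j) : ℝ)⁻¹ := by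
        refine sum_le_sum fun j _ => ?_
        rw [← mul_expect]
        gcongr
        exact expect_le_lsb_le m _
    _ = 384 * (2 ^ B : ℝ)⁻¹ * ∑ j ∈ range (m + 1), (3 / 4 : ℝ) ^ j := by
        rw [mul_sum]
        refine sum_congr rfl fun j _ => ?_
        rw [pow_add, mul_inv, show (3 / 4 : ℝ) = 3 / 2 * 2⁻¹ by norm_num, mul_pow, inv_pow]
        ring
    _ ≤ 384 * (2 ^ B : ℝ)⁻¹ * 4 := by
        gcongr
        rw [geom_sum_eq (by norm_num)]
        rw [show (3 / 4 - 1 : ℝ) = -(1 / 4) by norm_num]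
        have : (0 : ℝ) ≤ (3 / 4) ^ (m + 1) := by positivity
        linarith
    _ = _ := by ring

theorem expect_lsb_pow_le (m B : ℕ) {q : ℕ} (hq : 1 ≤ q) (hq4 : q ≤ 4) :
    𝔼 v : Fin (2 ^ m), ((lsb v + 1 - B : ℕ) : ℝ) ^ q ≤ 1536 * (2 ^ B : ℝ)⁻¹ := by
  refine (expect_le_expect fun v _ => ?_).trans (expect_lsb_pow_four_le m B)
  rcases Nat.eq_zero_or_pos (lsb v + 1 - B) with h | h
  · rw [h]
    rw [Nat.cast_zero, zero_pow (by omega)]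
    norm_num
  · exact pow_le_pow_right₀ (by exact_mod_cast h) hq4

/-! The level and the counters. -/

theorem seen_succ {n : ℕ} (x : ℕ → Fin n) (t : ℕ) : seen x (t + 1) = insert (x t) (seen x t) := by
  simp [seen, range_add_one, image_insert]

theorem seen_mono {n : ℕ} (x : ℕ → Fin n) : Monotone (seen x) := fun _ _ h =>
  image_subset_image (range_subset_range.2 h)

theorem F0_mono {n : ℕ} (x : ℕ → Fin n) : Monotone (F0 x) := fun _ _ h =>
  card_le_card (seen_mono x h)

theorem lt_two_pow_level (d : ℕ) {ε : ℝ} (hε : 0 < ε) (f : ℝ) :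
    f * ε ^ 2 < 2 ^ (d + level d ε f + 1) := by
  rcases le_or_gt f 0 with hf | hf
  · have : f * ε ^ 2 ≤ 0 := mul_nonpos_of_nonpos_of_nonneg hf (sq_nonneg ε)
    exact this.trans_lt (by positivity)
  · have h := Nat.lt_floor_add_one (Real.logb 2 (f * ε ^ 2) - d)
    rw [sub_lt_iff_lt_add, Real.logb_lt_iff_lt_rpow (by norm_num) (by positivity)] at h
    refine h.trans_eq ?_
    rw [← Real.rpow_natCast 2 (d + level d ε f + 1)]
    congr 1
    unfold level
    push_cast
    ring

theorem two_pow_level_le {d : ℕ} {ε : ℝ} (hε : 0 < ε) {f : ℝ} (hf : 0 ≤ f)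
    (h : level d ε f ≠ 0) : 2 ^ (d + level d ε f) ≤ f * ε ^ 2 := by
  rcases hf.eq_or_lt with hf | hf
  · subst hf
    -- For `f = 0` the logarithm takes its default value 0, so the level is 0.
    exact absurd (Nat.floor_of_nonpos (by simp)) h
  · have h1 := Nat.floor_le (a := Real.logb 2 (f * ε ^ 2) - d)
      (Nat.pos_of_floor_pos (Nat.pos_of_ne_zero h)).le
    rw [le_sub_iff_add_le, Real.le_logb_iff_rpow_le (by norm_num) (by positivity)] at h1
    refine le_trans (le_of_eq ?_) h1
    rw [← Real.rpow_natCast 2 (d + level d ε f)]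
    congr 1
    unfold level
    push_cast
    ring

/-- The level is a rounded logarithm. Rounding costs no extra unit, because the final comparison is
a strict inequality between powers of 2 with integer exponents. -/
theorem level_le_add (d : ℕ) {ε f g K : ℝ} (hε : 0 < ε) (hK : 0 < K) (hf : 0 ≤ f)
    (h : f ≤ K * g) : level d ε f ≤ level d ε g + ⌈Real.logb 2 K⌉₊ := by
  by_contra! hc
  have h1 := two_pow_level_le hε hf (by omega : level d ε f ≠ 0)
  have h2 := lt_two_pow_level d hε g
  have hK2 : K ≤ 2 ^ ⌈Real.logb 2 K⌉₊ := by
    rw [← Real.rpow_natCast, ← Real.logb_le_iff_le_rpow (by norm_num) hK]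
    exact Nat.le_ceil _
  have h3 : f * ε ^ 2 < 2 ^ ⌈Real.logb 2 K⌉₊ * 2 ^ (d + level d ε g + 1) :=
    calc f * ε ^ 2 ≤ K * g * ε ^ 2 := by gcongr
      _ = K * (g * ε ^ 2) := by ring
      _ < K * 2 ^ (d + level d ε g + 1) := by gcongr
      _ ≤ _ := by gcongr
  rw [← pow_add] at h3
  have h4 := (pow_lt_pow_iff_right₀ (by norm_num : (1 : ℝ) < 2)).1 (h1.trans_lt h3)
  omega

section Counters

variable {n k a d b : ℕ} {ε : ℝ}

/-- The counters after `t` elements. -/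
noncomputable def counters (a d b : ℕ) (ε : ℝ) (H : KNWHash n (logP a ε) k) (x : ℕ → Fin n)
    (f : ℕ → ℝ) (ω : Fin H.bits → Bool) (t : ℕ) : Fin (2 ^ logP a ε) → ℕ :=
  (knw a d b ε H).run x f ω t

variable {H : KNWHash n (logP a ε) k} {x : ℕ → Fin n} {f : ℕ → ℝ} {ω : Fin H.bits → Bool}

theorem counters_zero (i : Fin (2 ^ logP a ε)) : counters a d b ε H x f ω 0 i = 0 := rfl

theorem counters_succ (t : ℕ) (i : Fin (2 ^ logP a ε)) :
    counters a d b ε H x f ω (t + 1) i =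
      max (if counters a d b ε H x f ω t i = 0 then 0 else
          counters a d b ε H x f ω t i + (level d ε (f t) - b) - (level d ε (f (t + 1)) - b))
        (if H.hash₂ ω (x t) = i then lsb (H.hash₁ ω (x t)) + 1 - (level d ε (f (t + 1)) - b)
          else 0) := rfl

/-- Changing the offset `B` preserves `c + B` as long as `c` stays positive, so a nonzero counter
always has a witness in its bucket. -/
theorem exists_of_counters_ne_zero (t : ℕ) (i : Fin (2 ^ logP a ε))
    (h : counters a d b ε H x f ω t i ≠ 0) :
    ∃ s ∈ seen x t, H.hash₂ ω s = i ∧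
      counters a d b ε H x f ω t i + (level d ε (f t) - b) ≤ lsb (H.hash₁ ω s) + 1 := by
  induction t with
  | zero => exact absurd (counters_zero i) h
  | succ t ih =>
    rw [counters_succ] at h ⊢
    simp only [seen_succ, mem_insert]
    set u := counters a d b ε H x f ω t i
    set B' := level d ε (f (t + 1)) - b
    rcases max_cases (if u = 0 then 0 else u + (level d ε (f t) - b) - B')
      (if H.hash₂ ω (x t) = i then lsb (H.hash₁ ω (x t)) + 1 - B' else 0) with ⟨h1, _⟩ | ⟨h1, _⟩
    · rw [h1] at h ⊢
      split_ifs at h ⊢ with h0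
      · exact absurd rfl h
      · obtain ⟨s, hs, hi, hle⟩ := ih h0
        exact ⟨s, Or.inr hs, hi, by omega⟩
    · rw [h1] at h ⊢
      split_ifs at h ⊢ with h0
      · exact ⟨x t, Or.inl rfl, h0, by omega⟩
      · exact absurd rfl h

/-- Converse to the existence of witnesses: while `B` has never exceeded the `lsb` of `s`, the
counter of its bucket cannot have been truncated to zero since `s` arrived. -/
theorem le_counters_add (t : ℕ) {s : Fin n} (hs : s ∈ seen x t)
    (hB : ∀ t' ≤ t, level d ε (f t') - b ≤ lsb (H.hash₁ ω s)) :
    lsb (H.hash₁ ω s) + 1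
      ≤ counters a d b ε H x f ω t (H.hash₂ ω s) + (level d ε (f t) - b) := by
  induction t with
  | zero => simp [seen] at hs
  | succ t ih =>
    rw [seen_succ, mem_insert] at hs
    have hB' := hB (t + 1) le_rfl
    rw [counters_succ]
    by_cases hx : x t = s
    · subst hx
      rw [if_pos rfl]
      have := le_max_right (if counters a d b ε H x f ω t (H.hash₂ ω (x t)) = 0 then 0 else
          counters a d b ε H x f ω t (H.hash₂ ω (x t)) + (level d ε (f t) - b)
            - (level d ε (f (t + 1)) - b))
        (lsb (H.hash₁ ω (x t)) + 1 - (level d ε (f (t + 1)) - b))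
      omega
    · have h1 := ih (hs.resolve_left fun h => hx h.symm) fun t' ht' => hB t' (by omega)
      have h2 := hB t (by omega)
      rw [if_neg (by omega)]
      refine le_trans ?_ (Nat.add_le_add_right (le_max_left _ _) _)
      omega

/-- The quantity `c + B` can decrease only when `c` is or becomes zero, and then its old value was
at most an offset, hence at most `M`. -/
theorem counters_add_le_max {M t₁ : ℕ} (t : ℕ) (ht : t₁ ≤ t)
    (hM : ∀ t', t₁ ≤ t' → t' ≤ t → level d ε (f t') - b ≤ M) (i : Fin (2 ^ logP a ε)) :
    counters a d b ε H x f ω t₁ i + (level d ε (f t₁) - b)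
      ≤ max (counters a d b ε H x f ω t i + (level d ε (f t) - b)) M := by
  induction t, ht using Nat.le_induction with
  | base => exact le_max_left _ _
  | succ t ht ih =>
    have h1 := ih fun t' h h' => hM t' h (by omega)
    have h2 := hM t ht (by omega)
    rw [counters_succ]
    refine h1.trans (max_le ?_ (le_max_right _ _))
    by_cases h0 : counters a d b ε H x f ω t i = 0
    · rw [h0, zero_add]
      exact h2.trans (le_max_right _ _)
    · rw [if_neg h0]
      refine le_trans ?_ (le_max_left _ _)
      refine le_trans ?_ (Nat.add_le_add_right (le_max_left _ _) _)
      omega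

theorem length_natCode (c : ℕ) : (natCode c).length = 2 * Nat.size c + 1 := by
  simp only [natCode, List.length_append, List.length_replicate, List.length_cons,
    Nat.size_eq_bits_len]
  omega

theorem space_eq (t : ℕ) : (knw a d b ε H).space x f ω t
    = 2 ^ logP a ε + 2 * ∑ i, Nat.size (counters a d b ε H x f ω t i) := by
  change (counterCode (counters a d b ε H x f ω t)).length = _
  rw [counterCode, List.length_flatMap, List.map_ofFn, List.sum_ofFn]
  simp only [Function.comp_def, length_natCode]
  rw [sum_add_distrib, ← mul_sum]
  simp [add_comm]

theorem size_add_le (c q : ℕ) : Nat.size (c + q) ≤ Nat.size c + q := by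
  rw [Nat.size_le, pow_add]
  have h1 := Nat.lt_size_self c
  have h2 : q < 2 ^ q := Nat.lt_two_pow_self
  nlinarith

theorem size_le_self (c : ℕ) : Nat.size c ≤ c := by
  rw [Nat.size_le]
  exact Nat.lt_two_pow_self

/-- If no relevant element is ever discarded, then the output is computed from the elements of level
at least `D`. -/
theorem estimate_eq (t : ℕ) (hlev : ∀ t' ≤ t, level d ε (f t') ≤ level d ε (f t) + b) :
    (knw a d b ε H).estimate x f ω t = PhiInv (2 ^ logP a ε)
      (2 ^ logP a ε - (emptyBins ((seen x t).filter fun s => level d ε (f t) ≤ lsb (H.hash₁ ω s))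
        (H.hash₂ ω) : ℝ)) * 2 ^ level d ε (f t) := by
  have e : (univ.filter fun i => counters a d b ε H x f ω t i ≠ 0 ∧ level d ε (f t) + 1 ≤
      counters a d b ε H x f ω t i + (level d ε (f t) - b)).card
      + emptyBins ((seen x t).filter fun s => level d ε (f t) ≤ lsb (H.hash₁ ω s))
        (H.hash₂ ω) = 2 ^ logP a ε := by
    have h1 := card_filter_add_card_filter_not (s := (univ : Finset (Fin (2 ^ logP a ε))))
      (fun i => counters a d b ε H x f ω t i ≠ 0 ∧ level d ε (f t) + 1 ≤
        counters a d b ε H x f ω t i + (level d ε (f t) - b))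
    rw [card_univ, Fintype.card_fin] at h1
    refine Eq.trans ?_ h1
    rw [emptyBins, Nat.add_left_cancel_iff]
    congr 1
    ext i
    simp only [mem_filter, mem_univ, true_and, mem_singleton]
    constructor
    · rintro h ⟨h0, hle⟩
      obtain ⟨s, hs, hi, hle'⟩ := exists_of_counters_ne_zero t i h0
      exact h s ⟨hs, by omega⟩ hi
    · rintro h s ⟨hs, hle⟩ rfl
      apply h
      have := le_counters_add (a := a) (d := d) (b := b) (f := f) (ω := ω) t hs fun t' ht' => by
        have := hlev t' ht'
        omega
      exact ⟨by omega, by omega⟩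
  change PhiInv (2 ^ logP a ε) (((univ.filter fun i => counters a d b ε H x f ω t i ≠ 0 ∧
    level d ε (f t) + 1 ≤ counters a d b ε H x f ω t i + (level d ε (f t) - b)).card : ℕ) : ℝ)
    * 2 ^ level d ε (f t) = _
  congr 2
  rw [eq_sub_iff_add_eq]
  exact_mod_cast e

end Counters

/-! Existence of families of hash functions. -/

/-- Evaluating a random polynomial of degree less than `k` at up to `k` points is a surjective
additive map by Lagrange interpolation, and its fibres have equal size. The values are thus
independent and uniform on the field, and stay so after projection to `u` bits. -/
theorem exists_kWiseIndependent {M u k n q : ℕ} (hM : M ≠ 0) (hu : u ≤ M) (hn : n ≤ 2 ^ M)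
    (hq : q = 2 ^ u) : ∃ h : (Fin (M * k) → Bool) → Fin n → Fin q, KWiseIndependent k h := by
  classical
  subst hq
  let F := GaloisField 2 M
  have : Fintype F := Fintype.ofFinite F
  have hF : Fintype.card F = 2 ^ M := by
    rw [← Nat.card_eq_fintype_card]
    exact GaloisField.card 2 M hM
  have : Nonempty (Fin n ↪ F) :=
    Function.Embedding.nonempty_of_card_le (by rw [hF, Fintype.card_fin]; exact hn)
  obtain ⟨pt⟩ := this
  let coef : (Fin (M * k) → Bool) ≃ (Fin k → F) := Fintype.equivOfCardEq (by
    simp [hF, pow_mul])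
  -- An arbitrary bijection suffices: only the equal size of the fibres of its first component
  -- matters.
  let proj : F ≃ Fin (2 ^ u) × Fin (2 ^ (M - u)) := Fintype.equivOfCardEq (by
    rw [hF, Fintype.card_prod, Fintype.card_fin, Fintype.card_fin, ← pow_add]
    congr 1
    omega)
  refine ⟨fun ω s => (proj (∑ j : Fin k, coef ω j * pt s ^ (j : ℕ))).1, ?_⟩
  intro A hA y
  let L : (Fin k → F) →+ (A → F) :=
    { toFun := fun c a => ∑ j : Fin k, c j * pt a ^ (j : ℕ)
      map_zero' := by ext a; simp
      map_add' := fun c c' => by ext a; simp [add_mul, sum_add_distrib] }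
  have hL : Function.Surjective L := by
    intro z
    have hinj : Set.InjOn (fun a : A => pt a) ((univ : Finset A) : Set A) :=
      fun a _ b _ hab => Subtype.ext (pt.injective hab)
    let p := Lagrange.interpolate (univ : Finset A) (fun a : A => pt a) z
    have hp : p.degree < k := (Lagrange.degree_interpolate_lt z hinj).trans_le (by
      rw [card_univ, Fintype.card_coe]
      exact_mod_cast hA)
    refine ⟨fun j => p.coeff j, ?_⟩
    ext a
    have h1 : p.eval (pt a) = z a := Lagrange.eval_interpolate_at_node z hinj (mem_univ a)
    rcases Nat.eq_zero_or_pos k with hk | hk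
    · subst hk
      exact absurd (card_pos.2 ⟨_, a.2⟩) (by omega)
    · have hp' : p.natDegree < k := by
        rcases eq_or_ne p 0 with h0 | h0
        · simpa [h0] using hk
        · exact (Polynomial.natDegree_lt_iff_degree_lt h0).2 hp
      rw [Polynomial.eval_eq_sum_range' hp'] at h1
      rw [← h1]
      exact Fin.sum_univ_eq_sum_range (fun j => p.coeff j * pt a ^ j) k
  let T : Finset (A → F) := Fintype.piFinset fun a : A => univ.filter fun v => (proj v).1 = y a
  have hT : T.card = (2 ^ (M - u)) ^ A.card := by
    rw [Fintype.card_piFinset]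
    have : ∀ b, (univ.filter fun v => (proj v).1 = b).card = 2 ^ (M - u) := by
      intro b
      refine Eq.trans (Eq.symm ?_) ((card_univ (α := Fin (2 ^ (M - u)))).trans (Fintype.card_fin _))
      refine card_bij (fun v _ => proj.symm (b, v)) ?_ ?_ ?_
      · simp
      · intro v _ v' _ h
        simpa using h
      · intro v hv
        rw [mem_filter] at hv
        exact ⟨(proj v).2, mem_univ _, by rw [← hv.2]; simp⟩
    simp [this]
  let f := (univ.filter fun c => L c = 0).card
  have hfib : ∀ z, (univ.filter fun c => L c = z).card = f := fun z =>
    AddMonoidHom.card_fiber_eq_of_mem_range L (hL z) (hL 0)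
  have htot : (2 ^ M) ^ A.card * f = 2 ^ (M * k) := by
    have h1 := card_eq_sum_card_fiberwise (f := L) (s := univ) (t := univ) (by simp)
    simp_rw [hfib] at h1
    simp only [card_univ, Fintype.card_pi, hF, prod_const, sum_const, Fintype.card_coe,
      Fintype.card_fin, smul_eq_mul] at h1
    rw [← h1, pow_mul]
  have hcount : {ω | ∀ a ∈ A, (proj (∑ j : Fin k, coef ω j * pt a ^ (j : ℕ))).1 = y a}.ncard
      = T.card * f := by
    have h1 := card_eq_sum_card_fiberwise (f := L) (s := univ.filter fun c => L c ∈ T) (t := T)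
      (fun c hc => by simpa using hc)
    have h2 : ∀ z ∈ T, ((univ.filter fun c => L c ∈ T).filter fun c => L c = z).card = f := by
      intro z hz
      rw [← hfib z, filter_filter]
      congr 1
      ext c
      simp only [mem_filter, mem_univ, true_and, and_iff_right_iff_imp]
      rintro rfl
      exact hz
    rw [sum_congr rfl h2, sum_const, smul_eq_mul] at h1
    rw [← h1, ← Set.ncard_coe_finset, ← Set.ncard_image_of_injective _ coef.injective]
    congr 1
    ext c
    rw [coef.image_eq_preimage_symm]
    simp [T, L]
  unfold bitProb
  rw [hcount, hT, Fintype.card_fin, div_eq_iff (by positivity)]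
  have h3 : ((2 : ℝ) ^ u) ^ A.card * ((2 ^ (M - u)) ^ A.card * f) = 2 ^ (M * k) := by
    rw [← mul_assoc, ← mul_pow, ← pow_add, Nat.add_sub_cancel' hu]
    exact_mod_cast htot
  push_cast
  rw [← h3, inv_pow, inv_mul_cancel_left₀ (by positivity)]

theorem clog_two_le {n : ℕ} (hn : 1 ≤ n) : (Nat.clog 2 n : ℝ) ≤ 3 / 2 * Real.log n + 1 := by
  have h2 : (0.6931471803 : ℝ) < Real.log 2 := Real.log_two_gt_d9
  have hn0 : 0 ≤ Real.log n := Real.log_nonneg (by exact_mod_cast hn)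
  have h1 : (Nat.clog 2 n : ℝ) ≤ Real.logb 2 n + 1 := by
    rw [← Nat.cast_ofNat, ← Real.natCeil_logb_natCast]
    refine (Nat.ceil_lt_add_one (Real.logb_nonneg (by norm_num) (by exact_mod_cast hn))).le
  refine h1.trans ?_
  rw [Real.logb, add_le_add_iff_right, div_le_iff₀ (by linarith)]
  nlinarith

theorem logP_le {ε : ℝ} (hε : 0 < ε) (hε1 : ε < 1) (a : ℕ) :
    (logP a ε : ℝ) ≤ a + 1 + 3 * Real.log (1 / ε) := by
  have h2 : (0.6931471803 : ℝ) < Real.log 2 := Real.log_two_gt_d9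
  have hl : 0 ≤ Real.log (1 / ε) := Real.log_nonneg (by rw [le_div_iff₀ hε]; linarith)
  have hb : Real.logb 2 (1 / ε ^ 2) = 2 * Real.log (1 / ε) / Real.log 2 := by
    rw [Real.logb, show 1 / ε ^ 2 = (1 / ε) ^ 2 by ring, Real.log_pow]
    norm_num
  have h1 : Real.logb 2 (1 / ε ^ 2) ≤ 3 * Real.log (1 / ε) := by
    rw [hb, div_le_iff₀ (by linarith)]
    nlinarith
  have h0 : 0 ≤ Real.logb 2 (1 / ε ^ 2) := by
    rw [hb]
    exact div_nonneg (by linarith) (by linarith)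
  have := (Nat.ceil_lt_add_one h0).le
  unfold logP
  push_cast
  linarith

theorem exists_knwHash {n : ℕ} (hn : 1 ≤ n) {ε : ℝ} (hε : 0 < ε) (hε1 : ε < 1) (a : ℕ) :
    ∃ H : KNWHash n (logP a ε) (logP a ε ^ 1),
      (H.bits : ℝ) ≤ (146 + 14 * ((a : ℝ) + 1) ^ 2)
        * (1 + Real.log n + Real.log (1 / ε) ^ 2) := by
  set p := logP a ε with hp
  have hm : n ≤ 2 ^ Nat.clog 2 n := Nat.le_pow_clog (by norm_num) n
  set m := Nat.clog 2 n with hm'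
  -- The extra 1 in each field exponent keeps it nonzero even if `m` or `p` vanishes.
  obtain ⟨h₁, i₁⟩ := exists_kWiseIndependent (M := m + 1) (u := m) (k := 8) (n := n) (q := 2 ^ m)
    (by omega) (by omega) (hm.trans (Nat.pow_le_pow_right (by norm_num) (by omega))) rfl
  obtain ⟨h₃, i₃⟩ := exists_kWiseIndependent (M := m + 2 * p + 1) (u := 2 * p) (k := 2) (n := n)
    (q := (2 ^ p) ^ 2) (by omega) (by omega)
    (hm.trans (Nat.pow_le_pow_right (by norm_num) (by omega))) (by rw [← pow_mul, mul_comm])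
  obtain ⟨h₄, i₄⟩ := exists_kWiseIndependent (M := 2 * p + 1) (u := p) (k := p ^ 1)
    (n := (2 ^ p) ^ 2) (q := 2 ^ p) (by omega) (by omega)
    (by rw [← pow_mul]; exact Nat.pow_le_pow_right (by norm_num) (by omega)) rfl
  refine ⟨⟨_, _, _, h₁, h₃, h₄, i₁, i₃, i₄⟩, ?_⟩
  have hbm := clog_two_le hn
  have hbp := logP_le hε hε1 a
  rw [← hp] at hbp
  rw [← hm'] at hbm
  have hn0 : 0 ≤ Real.log n := Real.log_nonneg (by exact_mod_cast hn)
  have hl : 0 ≤ Real.log (1 / ε) := Real.log_nonneg (by rw [le_div_iff₀ hε]; linarith)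
  generalize Real.log (1 / ε) = l at *
  generalize Real.log n = N at *
  have hpp : (p : ℝ) ≤ (p : ℝ) ^ 2 := by
    exact_mod_cast Nat.le_self_pow (by norm_num) p
  have hp2 : (p : ℝ) ^ 2 ≤ 2 * ((a : ℝ) + 1) ^ 2 + 18 * l ^ 2 := by
    have : (p : ℝ) ^ 2 ≤ ((a : ℝ) + 1 + 3 * l) ^ 2 := by gcongr
    nlinarith [sq_nonneg ((a : ℝ) + 1 - 3 * l)]
  have hA : 0 ≤ ((a : ℝ) + 1) ^ 2 := sq_nonneg _
  simp only [KNWHash.bits]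
  push_cast
  nlinarith [mul_nonneg hA hn0, mul_nonneg hA (sq_nonneg l)]

/-! Consequences of tracking. -/

section Tracking

variable {n : ℕ} {C : ℝ} {T : ℕ} {x : ℕ → Fin n} {f : ℕ → ℝ}

theorem Tracks.nonneg (h : Tracks C T x f) (hC : 1 ≤ C) {t : ℕ} (ht : t ≤ T) : 0 ≤ f t :=
  le_trans (by positivity) (h t ht).1

theorem Tracks.F0_le (h : Tracks C T x f) (hC : 1 ≤ C) {t : ℕ} (ht : t ≤ T) :
    (F0 x t : ℝ) ≤ C * f t := by
  have := (h t ht).1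
  rw [one_div, inv_mul_le_iff₀ (by linarith)] at this
  exact this

/-- Tracking loses a factor `C` at each of the two times, and `F0` contributes the factor 2.
Accuracy needs this for `t' ≤ t`, monotonicity of space for `t'` between `t₁` and `t₂`. -/
theorem Tracks.level_le (h : Tracks C T x f) (hC : 1 ≤ C) {ε : ℝ} (hε : 0 < ε) (d : ℕ) {t t' : ℕ}
    (ht : t ≤ T) (ht' : t' ≤ T) (hF : (F0 x t' : ℝ) ≤ 2 * F0 x t) :
    level d ε (f t') ≤ level d ε (f t) + ⌈Real.logb 2 (2 * C ^ 2)⌉₊ := by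
  refine level_le_add d hε (by positivity) (h.nonneg hC ht') ?_
  calc f t' ≤ C * F0 x t' := (h t' ht').2
    _ ≤ C * (2 * (C * f t)) := by
      gcongr
      exact hF.trans (by gcongr; exact h.F0_le hC ht)
    _ = _ := by ring

theorem Tracks.F0_mul_le (h : Tracks C T x f) (hC : 1 ≤ C) {ε : ℝ} (hε : 0 < ε) (d : ℕ) {t : ℕ}
    (ht : t ≤ T) : F0 x t * ε ^ 2 ≤ C * 2 ^ (d + level d ε (f t) + 1) :=
  calc F0 x t * ε ^ 2 ≤ C * f t * ε ^ 2 := by gcongr; exact h.F0_le hC ht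
    _ = C * (f t * ε ^ 2) := by ring
    _ ≤ _ := by gcongr; exact (lt_two_pow_level d hε _).le

theorem Tracks.two_pow_le (h : Tracks C T x f) (hC : 1 ≤ C) {ε : ℝ} (hε : 0 < ε) {d : ℕ} {t : ℕ}
    (ht : t ≤ T) (h0 : level d ε (f t) ≠ 0) :
    2 ^ (d + level d ε (f t)) ≤ C * F0 x t * ε ^ 2 :=
  (two_pow_level_le hε (h.nonneg hC ht) h0).trans (by gcongr; exact (h t ht).2)

end Tracking

/-! ### The number of counters. -/

theorem le_two_pow_logP (a : ℕ) {ε : ℝ} (hε : 0 < ε) :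
    2 ^ a / ε ^ 2 ≤ (2 : ℝ) ^ logP a ε := by
  unfold logP
  rw [pow_add, div_eq_mul_one_div]
  gcongr
  rw [← Real.rpow_natCast 2 ⌈_⌉₊, ← Real.logb_le_iff_le_rpow (by norm_num) (by positivity)]
  exact Nat.le_ceil _

theorem two_pow_logP_le (a : ℕ) {ε : ℝ} (hε : 0 < ε) (hε1 : ε < 1) :
    (2 : ℝ) ^ logP a ε ≤ 2 ^ (a + 1) / ε ^ 2 := by
  unfold logP
  rw [pow_add, pow_succ 2 a, mul_div_assoc]
  gcongr
  have h1 : 1 ≤ 1 / ε ^ 2 := by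
    rw [le_div_iff₀ (by positivity), one_mul]
    exact pow_le_one₀ hε.le hε1.le
  have h2 := (Nat.ceil_lt_add_one (Real.logb_nonneg (by norm_num : (1 : ℝ) < 2) h1)).le
  rw [← Real.rpow_natCast 2 ⌈_⌉₊]
  calc (2 : ℝ) ^ (⌈Real.logb 2 (1 / ε ^ 2)⌉₊ : ℝ) ≤ 2 ^ (Real.logb 2 (1 / ε ^ 2) + 1) :=
        Real.rpow_le_rpow_of_exponent_le (by norm_num) h2
    _ = 2 / ε ^ 2 := by
        rw [Real.rpow_add (by norm_num), Real.rpow_logb (by norm_num) (by norm_num) (by positivity),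
          Real.rpow_one]
        ring

/-! Space. -/

section Space

variable {n k a d b : ℕ} {ε : ℝ} {H : KNWHash n (logP a ε) k} {x : ℕ → Fin n} {f : ℕ → ℝ}

theorem space_le_space_add {q t₁ t₂ : ℕ} (ht : t₁ ≤ t₂)
    (hlev : ∀ t', t₁ ≤ t' → t' ≤ t₂ → level d ε (f t') ≤ level d ε (f t₁) + q)
    (ω : Fin H.bits → Bool) :
    (knw a d b ε H).space x f ω t₁ ≤ (knw a d b ε H).space x f ω t₂ + 2 ^ logP a ε * (2 * q) := by
  rw [space_eq, space_eq]
  have hc : ∀ i, Nat.size (counters a d b ε H x f ω t₁ i)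
      ≤ Nat.size (counters a d b ε H x f ω t₂ i) + q := by
    intro i
    have h1 := counters_add_le_max (a := a) (d := d) (b := b) (H := H) (x := x) (f := f) (ω := ω)
      -- With this `M`, and since the offset at `t₂` is also at most `M`, the counter at `t₁`
      -- exceeds the one at `t₂` by at most `q`.
      (M := level d ε (f t₁) - b + q) t₂ ht (fun t' h h' => by have := hlev t' h h'; omega) i
    have h2 := hlev t₂ ht le_rfl
    refine le_trans (Nat.size_le_size ?_) (size_add_le _ q)
    omega
  have h3 := sum_le_sum fun i (_ : i ∈ univ) => hc i
  rw [sum_add_distrib, sum_const, card_univ, Fintype.card_fin, smul_eq_mul] at h3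
  nlinarith

theorem sum_counters_le (ω : Fin H.bits → Bool) (t : ℕ) :
    ∑ i, counters a d b ε H x f ω t i
      ≤ ∑ s ∈ seen x t, (lsb (H.hash₁ ω s) + 1 - (level d ε (f t) - b)) := by
  rw [← sum_fiberwise (seen x t) (H.hash₂ ω)]
  refine sum_le_sum fun i _ => ?_
  rcases eq_or_ne (counters a d b ε H x f ω t i) 0 with h0 | h0
  · rw [h0]
    exact Nat.zero_le _
  · obtain ⟨s, hs, hi, hle⟩ := exists_of_counters_ne_zero t i h0
    refine le_trans ?_ (single_le_sum (fun _ _ => Nat.zero_le _) (mem_filter.2 ⟨hs, hi⟩))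
    omega

/-- Pigeonhole: some counter has more than `r` binary digits, so its value is at least `2 ^ r`. -/
theorem exists_lsb_of_lt_space {r t : ℕ} {ω : Fin H.bits → Bool}
    (h : 2 ^ logP a ε * (1 + 2 * r) < (knw a d b ε H).space x f ω t) :
    ∃ s ∈ seen x t, (level d ε (f t) - b) + 2 ^ r ≤ lsb (H.hash₁ ω s) + 1 := by
  obtain ⟨i, hi⟩ : ∃ i, r < Nat.size (counters a d b ε H x f ω t i) := by
    by_contra! hc
    have h1 := sum_le_sum fun i (_ : i ∈ univ) => hc i
    rw [sum_const, card_univ, Fintype.card_fin, smul_eq_mul] at h1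
    rw [space_eq] at h
    nlinarith
  rw [Nat.lt_size] at hi
  obtain ⟨s, hs, -, hle⟩ := exists_of_counters_ne_zero t i
    ((pow_pos (by norm_num : 0 < 2) r).trans_le hi).ne'
  exact ⟨s, hs, by omega⟩

theorem hash₁_append (H : KNWHash n (logP a ε) k) (u : Fin H.r₁ → Bool) (v : Fin H.r₃ → Bool)
    (w : Fin H.r₄ → Bool) : H.hash₁ (Fin.append (Fin.append u v) w) = H.h₁ u := by
  funext s
  simp [KNWHash.hash₁]

theorem hash₂_append (H : KNWHash n (logP a ε) k) (u : Fin H.r₁ → Bool) (v : Fin H.r₃ → Bool)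
    (w : Fin H.r₄ → Bool) : H.hash₂ (Fin.append (Fin.append u v) w) = fun s => H.h₄ w (H.h₃ v s) := by
  funext s
  simp [KNWHash.hash₂]

theorem bitProb_hash₁_le (H : KNWHash n (logP a ε) k)
    (p : (Fin n → Fin (2 ^ Nat.clog 2 n)) → Prop) :
    bitProb {ω : Fin H.bits → Bool | p (H.hash₁ ω)} ≤ bitProb {u | p (H.h₁ u)} := by
  refine bitProb_le_of_forall_right fun w => bitProb_le_of_forall_right fun v => ?_
  refine bitProb_mono fun u hu => ?_
  simp only [Set.mem_ofPred_eq] at hu ⊢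
  exact hash₁_append H u v w ▸ hu

/-- The mean is at most `1536 G` and the allowed deviation is `3072 G`. The fourth central moment is
`O(G²)`, so dividing by the fourth power of the deviation leaves `1 / G²`; a second moment would
give only the order `1 / G`. -/
theorem bitProb_sum_lsb_le {r m : ℕ} {α : Type} [DecidableEq α] {h : (Fin r → Bool) → α → Fin (2 ^ m)}
    (hh : KWiseIndependent 8 h) (A : Finset α) (B : ℕ) {G : ℝ} (hG : 1 ≤ G)
    (hA : A.card * (2 ^ B : ℝ)⁻¹ ≤ G) :
    bitProb {u | 4608 * G ≤ ∑ s ∈ A, ((lsb (h u s) + 1 - B : ℕ) : ℝ)} ≤ 1 / G ^ 2 := by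
  have : Nonempty (Fin (2 ^ m)) := ⟨⟨0, by positivity⟩⟩
  have e1 := expect_lsb_pow_le m B (q := 1) le_rfl (by norm_num)
  have e2 := expect_lsb_pow_le m B (q := 2) (by norm_num) (by norm_num)
  have e4 := expect_lsb_pow_le m B (q := 4) (by norm_num) le_rfl
  simp only [pow_one] at e1
  have key := hh.bitProb_add_le (by norm_num) A (fun v => ((lsb v + 1 - B : ℕ) : ℝ))
    (fun v => Nat.cast_nonneg _) (τ := 3072 * G) (by positivity)
  set y : ℝ := (2 ^ B : ℝ)⁻¹
  have hy0 : 0 ≤ y := by positivity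
  have hy1 : y ≤ 1 := inv_le_one_of_one_le₀ (one_le_pow₀ (by norm_num))
  set N : ℝ := (A.card : ℝ)
  have hN0 : 0 ≤ N := Nat.cast_nonneg _
  set m1 := 𝔼 v : Fin (2 ^ m), ((lsb v + 1 - B : ℕ) : ℝ)
  set m2 := 𝔼 v : Fin (2 ^ m), ((lsb v + 1 - B : ℕ) : ℝ) ^ 2
  set m4 := 𝔼 v : Fin (2 ^ m), ((lsb v + 1 - B : ℕ) : ℝ) ^ 4
  have hm1 : 0 ≤ m1 := expect_nonneg fun v _ => Nat.cast_nonneg _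
  have hm2 : 0 ≤ m2 := expect_nonneg fun v _ => by positivity
  have hN1 : N * m1 ≤ 1536 * G := by nlinarith
  have hN2 : N * m2 ≤ 1536 * G := by nlinarith
  have hN4 : N * m4 ≤ 1536 * G := by nlinarith
  have hm14 : m1 ^ 4 ≤ 1536 ^ 4 * y := by
    calc m1 ^ 4 ≤ (1536 * y) ^ 4 := by gcongr
      _ = 1536 ^ 4 * (y ^ 3 * y) := by ring
      _ ≤ 1536 ^ 4 * (1 * y) := by
        gcongr
        exact pow_le_one₀ hy0 hy1
      _ = _ := by ring
  have hNm : N * m1 ^ 4 ≤ 1536 ^ 4 * G := by nlinarith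
  refine (bitProb_mono ?_).trans (key.trans ?_)
  · intro u hu
    simp only [Set.mem_ofPred_eq] at hu ⊢
    linarith
  · rw [div_le_div_iff₀ (by positivity) (by positivity), one_mul]
    have h1 : 3 * (N * m2) ^ 2 ≤ 3 * (1536 * G) ^ 2 := by
      have : 0 ≤ N * m2 := by positivity
      gcongr
    have h2 : N * (m4 + m1 ^ 4) ≤ (1536 + 1536 ^ 4) * G ^ 2 := by nlinarith
    calc (3 * (N * m2) ^ 2 + N * (m4 + m1 ^ 4)) * G ^ 2
        ≤ (3 * (1536 * G) ^ 2 + (1536 + 1536 ^ 4) * G ^ 2) * G ^ 2 := by gcongr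
      _ = (3 * 1536 ^ 2 + 1536 + 1536 ^ 4) * G ^ 4 := by ring
      _ ≤ 3072 ^ 4 * G ^ 4 := by gcongr; norm_num
      _ = _ := by ring

theorem bitProb_exists_lsb_le {r m : ℕ} {α : Type} [DecidableEq α]
    {h : (Fin r → Bool) → α → Fin (2 ^ m)}
    (hh : KWiseIndependent 8 h) (A : Finset α) (B : ℕ) {L : ℕ} (hL : 1 ≤ L) {G : ℝ}
    (hA : A.card * (2 ^ B : ℝ)⁻¹ ≤ G) :
    bitProb {u | ∃ s ∈ A, B + L ≤ lsb (h u s) + 1} ≤ 2 * G / 2 ^ L := by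
  obtain ⟨L, rfl⟩ := Nat.exists_eq_add_of_le' hL
  refine (bitProb_biUnion_le A fun s => {u | B + (L + 1) ≤ lsb (h u s) + 1}).trans ?_
  have : ∀ s, bitProb {u | B + (L + 1) ≤ lsb (h u s) + 1} ≤ (2 ^ (B + L) : ℝ)⁻¹ := by
    intro s
    have h1 := hh.expect_apply (by norm_num) s (fun v => if B + L ≤ lsb v then (1 : ℝ) else 0)
    have h2 := expect_le_lsb_le m (B + L)
    rw [← h1, expect_ite_eq_bitProb] at h2
    refine le_trans (bitProb_mono fun u hu => ?_) h2
    simp only [Set.mem_ofPred_eq] at hu ⊢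
    omega
  calc _ ≤ ∑ s ∈ A, (2 ^ (B + L) : ℝ)⁻¹ := sum_le_sum fun s _ => this s
    _ = A.card * (2 ^ B : ℝ)⁻¹ * (2 ^ L)⁻¹ := by
      rw [sum_const, nsmul_eq_mul, pow_add, mul_inv, mul_assoc]
    _ ≤ G * (2 ^ L)⁻¹ := by gcongr
    _ = _ := by rw [pow_succ]; field_simp

variable {C : ℝ} {T : ℕ}

theorem Tracks.card_seen_mul_le (h : Tracks C T x f) (hC : 1 ≤ C) (hε : 0 < ε) (d b : ℕ) {t : ℕ}
    (ht : t ≤ T) : (seen x t).card * (2 ^ (level d ε (f t) - b) : ℝ)⁻¹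
      ≤ C * 2 ^ (d + b + 1) / ε ^ 2 := by
  have h1 := h.F0_mul_le hC hε d ht
  rw [mul_inv_le_iff₀ (by positivity), div_mul_eq_mul_div, le_div_iff₀ (by positivity)]
  refine h1.trans ?_
  rw [mul_assoc, ← pow_add]
  exact mul_le_mul_of_nonneg_left (pow_le_pow_right₀ (by norm_num) (by omega)) (by linarith)

/-- The summand `2 ^ (a + 1)` pays for the `P` separators; `9216 = 2 * 4608` because every digit of
a counter costs two bits of code. -/
theorem bitProb_lt_space_le (hT : Tracks C T x f) (hC : 1 ≤ C) (hε : 0 < ε) (hε1 : ε < 1) {t : ℕ}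
    (ht : t ≤ T) : bitProb {ω | (2 ^ (a + 1) + 9216 * (C * 2 ^ (d + b + 1))) / ε ^ 2
      < ((knw a d b ε H).space x f ω t : ℝ)} ≤ ε ^ 4 := by
  set g := C * 2 ^ (d + b + 1) with hg
  have hg1 : 1 ≤ g := one_le_mul_of_one_le_of_one_le hC (one_le_pow₀ (by norm_num))
  have hε2 : ε ^ 2 ≤ 1 := pow_le_one₀ hε.le hε1.le
  have hG : 1 ≤ g / ε ^ 2 := by
    rw [le_div_iff₀ (by positivity)]
    linarith
  have key := bitProb_sum_lsb_le H.indep₁ (seen x t) (level d ε (f t) - b) hG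
    (hT.card_seen_mul_le hC hε d b ht)
  have hash := bitProb_hash₁_le H fun h => 4608 * (g / ε ^ 2) ≤
    ∑ s ∈ seen x t, ((lsb (h s) + 1 - (level d ε (f t) - b) : ℕ) : ℝ)
  refine le_trans ?_ ((hash.trans key).trans ?_)
  · refine bitProb_mono fun ω hω => ?_
    simp only [Set.mem_ofPred_eq] at hω ⊢
    have h1 : ∑ i, Nat.size (counters a d b ε H x f ω t i)
        ≤ ∑ s ∈ seen x t, (lsb (H.hash₁ ω s) + 1 - (level d ε (f t) - b)) :=
      (sum_le_sum fun i _ => size_le_self _).trans (sum_counters_le ω t)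
    have h2 : ((∑ i, Nat.size (counters a d b ε H x f ω t i) : ℕ) : ℝ)
        ≤ ∑ s ∈ seen x t, ((lsb (H.hash₁ ω s) + 1 - (level d ε (f t) - b) : ℕ) : ℝ) := by
      exact_mod_cast h1
    have h3 := two_pow_logP_le a hε hε1
    rw [space_eq] at hω
    push_cast at hω h2
    rw [add_div, mul_div_assoc] at hω
    linarith
  · rw [div_pow, one_div_div, ← pow_mul]
    exact div_le_self (by positivity) (one_le_pow₀ hg1)

theorem bitProb_lt_space_le_exp (hT : Tracks C T x f) (hC : 1 ≤ C) (hε : 0 < ε) (hε1 : ε < 1)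
    {t : ℕ} (ht : t ≤ T) {lam : ℝ}
    (h1 : 2 ^ (a + 1) + 9216 * (C * 2 ^ (d + b + 1)) ≤ lam)
    (h2 : (10 + 6 * Real.log (2 * (C * 2 ^ (d + b + 1)))) / (Real.log 2 / 2 ^ (a + 3)) ≤ lam) :
    bitProb {ω | lam / ε ^ 2 < ((knw a d b ε H).space x f ω t : ℝ)}
      ≤ Real.exp (-Real.exp (Real.log 2 / 2 ^ (a + 3) * lam)) := by
  have hl2 : (0.6931471803 : ℝ) < Real.log 2 := Real.log_two_gt_d9
  set g := C * 2 ^ (d + b + 1) with hg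
  set E := Real.exp (Real.log 2 / 2 ^ (a + 3) * lam) with hE
  have hg1 : 1 ≤ g := one_le_mul_of_one_le_of_one_le hC (one_le_pow₀ (by norm_num))
  -- In the first case `ε ^ 4 ≤ exp (-E)`; in the second `1 / ε ^ 2` is at most `exp (E / 2)`, which
  -- the union bound can afford.
  rcases le_or_gt E (4 * Real.log (1 / ε)) with hcase | hcase
  · refine le_trans (bitProb_mono fun ω hω => ?_)
      ((bitProb_lt_space_le (a := a) (d := d) (b := b) (H := H) hT hC hε hε1 ht).trans ?_)
    · simp only [Set.mem_ofPred_eq] at hω ⊢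
      refine lt_of_le_of_lt ?_ hω
      gcongr
    · rw [← Real.exp_log (pow_pos hε 4), Real.exp_le_exp, Real.log_pow]
      rw [one_div, Real.log_inv] at hcase
      push_cast
      linarith
  · have hEε : 1 / ε ^ 2 ≤ Real.exp (E / 2) := by
      rw [← Real.log_le_iff_le_exp (by positivity), show 1 / ε ^ 2 = (1 / ε) ^ 2 by ring,
        Real.log_pow]
      push_cast
      linarith
    -- The largest `r` with `(1 + 2 r) 2 ^ (a + 1) ≤ lam`, so that the pigeonhole lemma applies.
    set r := ⌊(lam / 2 ^ (a + 1) - 1) / 2⌋₊ with hr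
    have hlam : 1 ≤ lam / 2 ^ (a + 1) := by
      rw [le_div_iff₀ (by positivity)]
      linarith
    have hr1 : (1 + 2 * (r : ℝ)) * 2 ^ (a + 1) ≤ lam := by
      have := Nat.floor_le (a := (lam / 2 ^ (a + 1) - 1) / 2) (by linarith)
      rw [← le_div_iff₀ (by positivity)]
      linarith
    have hr2 : lam / 2 ^ (a + 1) / 2 ≤ r + 3 / 2 := by
      have := (Nat.lt_floor_add_one ((lam / 2 ^ (a + 1) - 1) / 2)).le
      linarith
    -- The rate `log 2 / 2 ^ (a + 3)` is half of what `2 ^ r` would allow. The resulting exponent,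
    -- quadratic in `E`, beats the linear terms once `E ≥ 10 + 6 log (2 g)`.
    have hE2 : E ^ 2 ≤ 4 * (2 : ℝ) ^ r := by
      have e1 : E ^ 2 = Real.exp (Real.log 2 * (lam / 2 ^ (a + 1) / 2)) := by
        rw [hE, ← Real.exp_nat_mul]
        congr 1
        rw [pow_add, pow_add]
        push_cast
        ring
      have e2 : 4 * (2 : ℝ) ^ r = Real.exp (Real.log 2 * (r + 2)) := by
        rw [Real.exp_mul, Real.exp_log (by norm_num)]
        norm_cast
        rw [pow_add]
        ring
      rw [e1, e2, Real.exp_le_exp]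
      exact mul_le_mul_of_nonneg_left (by linarith) (by linarith)
    have hEbig : 10 + 6 * Real.log (2 * g) ≤ E := by
      rw [div_le_iff₀ (by positivity), mul_comm] at h2
      linarith [Real.add_one_le_exp (Real.log 2 / 2 ^ (a + 3) * lam)]
    have hlg : 0 ≤ Real.log (2 * g) := Real.log_nonneg (by linarith)
    refine le_trans (bitProb_mono ?_) (((bitProb_hash₁_le H fun h => ∃ s ∈ seen x t,
      (level d ε (f t) - b) + 2 ^ r ≤ lsb (h s) + 1).trans (bitProb_exists_lsb_le H.indep₁ _ _
        (Nat.one_le_two_pow) (hT.card_seen_mul_le hC hε d b ht))).trans ?_)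
    · intro ω hω
      simp only [Set.mem_ofPred_eq] at hω ⊢
      refine exists_lsb_of_lt_space ?_
      have : (2 : ℝ) ^ logP a ε * (1 + 2 * r) < ((knw a d b ε H).space x f ω t : ℝ) := by
        refine lt_of_le_of_lt ?_ hω
        calc (2 : ℝ) ^ logP a ε * (1 + 2 * r) ≤ 2 ^ (a + 1) / ε ^ 2 * (1 + 2 * r) := by
              gcongr
              exact two_pow_logP_le a hε hε1
          _ = (1 + 2 * r) * 2 ^ (a + 1) / ε ^ 2 := by ring
          _ ≤ _ := by gcongr
      exact_mod_cast this
    · rw [← hg]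
      have e3 : (2 : ℝ) ^ (2 ^ r : ℕ) = Real.exp (Real.log 2 * (2 : ℝ) ^ r) := by
        rw [Real.exp_mul, Real.exp_log (by norm_num)]
        norm_cast
      calc 2 * (g / ε ^ 2) / 2 ^ (2 ^ r) = (2 * g) * (1 / ε ^ 2) / 2 ^ (2 ^ r) := by ring
        _ ≤ Real.exp (Real.log (2 * g)) * Real.exp (E / 2)
            / Real.exp (Real.log 2 * (2 : ℝ) ^ r) := by
          rw [e3, Real.exp_log (by positivity)]
          gcongr
        _ = Real.exp (Real.log (2 * g) + E / 2 - Real.log 2 * (2 : ℝ) ^ r) := by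
          rw [← Real.exp_add, ← Real.exp_sub]
        _ ≤ _ := by
          rw [Real.exp_le_exp]
          have h5 : 0.6931471803 * (E ^ 2 / 4) ≤ Real.log 2 * (2 : ℝ) ^ r := by
            gcongr
            linarith
          nlinarith

end Space

/-! Accuracy. -/

theorem KWiseIndependent.bitProb_not_injOn_le {r : ℕ} {α β : Type} [Fintype β] [DecidableEq α]
    {h : (Fin r → Bool) → α → β} (hh : KWiseIndependent 2 h) (A : Finset α) :
    bitProb {ω | ¬ Set.InjOn (h ω) A} ≤ (A.card : ℝ) ^ 2 / Fintype.card β := by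
  have hpair : ∀ q ∈ A.offDiag, bitProb {ω | h ω q.1 = h ω q.2} ≤ (Fintype.card β : ℝ)⁻¹ := by
    rintro ⟨s, s'⟩ hq
    rw [mem_offDiag] at hq
    refine le_trans (bitProb_mono ?_)
      ((bitProb_biUnion_le univ fun v : β => {ω | ∀ c ∈ ({s, s'} : Finset α), h ω c = v}).trans ?_)
    · intro ω hω
      refine ⟨h ω s, mem_univ _, ?_⟩
      simp only [Set.mem_ofPred_eq] at hω ⊢
      simp [hω]
    · have : ∀ v : β, bitProb {ω | ∀ c ∈ ({s, s'} : Finset α), h ω c = v}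
          = (Fintype.card β : ℝ)⁻¹ ^ 2 := by
        intro v
        have := hh {s, s'} (card_le_two) fun _ => v
        rwa [card_pair hq.2.2] at this
      simp_rw [this]
      rw [sum_const, card_univ, nsmul_eq_mul, pow_two, ← mul_assoc]
      rcases eq_or_ne (Fintype.card β : ℝ) 0 with h0 | h0
      · simp [h0]
      · rw [mul_inv_cancel₀ h0, one_mul]
  refine le_trans (bitProb_mono ?_)
    ((bitProb_biUnion_le A.offDiag fun q => {ω | h ω q.1 = h ω q.2}).trans
      ((sum_le_sum hpair).trans ?_))
  · intro ω hω
    simp only [Set.mem_ofPred_eq, Set.InjOn, not_forall] at hω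
    obtain ⟨s, hs, s', hs', he, hne⟩ := hω
    exact ⟨(s, s'), mem_offDiag.2 ⟨hs, hs', hne⟩, he⟩
  · rw [sum_const, nsmul_eq_mul, div_eq_mul_inv]
    gcongr
    rw [offDiag_card, pow_two]
    exact_mod_cast Nat.sub_le _ _

/-- Reduces `h₂` to `h₄` on the image under `h₃`, which has as many points as `A` when `h₃` is
injective there. -/
theorem emptyBins_image {α β γ : Type} [Fintype γ] [DecidableEq β] [DecidableEq γ] (A : Finset α)
    (g : α → β) (h : β → γ) : emptyBins (A.image g) h = emptyBins A fun s => h (g s) := by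
  simp [emptyBins]

/-- With `μ = P (1 - 1/P)^N`, the difference equals `log (V / μ) / log (1 - 1/P)`. The numerator is
at most `δ / (P / 2)` in absolute value, since `V` and `μ` are both at least `P / 2`, and the
denominator is at least `1 / P`. -/
theorem abs_PhiInv_sub_le {P N : ℕ} (hP : 2 ≤ P) (hN : (N : ℝ) ≤ P / 64) {V δ : ℝ}
    (hδ : δ ≤ P / 256) (hV : |V - P * (1 - 1 / (P : ℝ)) ^ N| ≤ δ) :
    |PhiInv P (P - V) - N| ≤ 2 * δ := by
  have hP2 : (2 : ℝ) ≤ P := by exact_mod_cast hP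
  have hP0 : (0 : ℝ) < P := by linarith
  set y := 1 / (P : ℝ) with hy
  have hy0 : 0 < y := by positivity
  have hPy : P * y = 1 := by rw [hy]; field_simp
  have hy2 : y ≤ 1 / 2 := by
    rw [hy]
    gcongr
  set μ := P * (1 - y) ^ N with hμ
  have hμP : (63 / 64 : ℝ) * P ≤ μ := by
    have h1 := one_add_mul_le_pow (a := -y) (by linarith) N
    calc (63 / 64 : ℝ) * P ≤ P - N := by linarith
      _ = P * (1 + N * -y) := by rw [mul_add, mul_one, mul_left_comm, mul_neg, hPy]; ring
      _ ≤ P * (1 + -y) ^ N := by gcongr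
      _ = μ := by rw [hμ, sub_eq_add_neg]
  have hV' := abs_le.1 hV
  have hVP : (1 / 2 : ℝ) * P ≤ V := by linarith
  have hV0 : 0 < V := by linarith
  have hμ0 : 0 < μ := by linarith
  have hl : Real.log (1 - y) ≤ -y := by
    have := Real.log_le_sub_one_of_pos (x := 1 - y) (by linarith)
    linarith
  have hl0 : Real.log (1 - y) < 0 := by linarith
  have hN' : (N : ℝ) = Real.log (μ / P) / Real.log (1 - y) := by
    rw [hμ, mul_div_cancel_left₀ _ hP0.ne', Real.log_pow, mul_div_cancel_right₀ _ hl0.ne]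
  have hΦ : PhiInv P (P - V) - N = Real.log (V / μ) / Real.log (1 - y) := by
    have e1 : 1 - (P - V) / (P : ℝ) = V / P := by field_simp; ring
    rw [PhiInv, e1, hN', ← sub_div, ← Real.log_div (by positivity) (by positivity)]
    congr 2
    field_simp
  have hδ0 : 0 ≤ δ := (abs_nonneg _).trans hV
  have hlog : |Real.log (V / μ)| ≤ 2 * δ * y := by
    have e : 2 * δ * y = δ / (1 / 2 * P) := by rw [hy]; field_simp
    rw [e, abs_le]
    constructor
    · have h1 := Real.log_le_sub_one_of_pos (x := μ / V) (by positivity)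
      rw [← inv_div V μ, Real.log_inv, inv_div] at h1
      have h2 : μ / V - 1 ≤ δ / (1 / 2 * P) := by
        rw [div_sub_one hV0.ne']
        exact div_le_div₀ hδ0 (by linarith) (by positivity) hVP
      linarith
    · have h1 := Real.log_le_sub_one_of_pos (x := V / μ) (by positivity)
      have h2 : V / μ - 1 ≤ δ / (1 / 2 * P) := by
        rw [div_sub_one hμ0.ne']
        exact div_le_div₀ hδ0 (by linarith) (by positivity) (by linarith)
      linarith
  rw [hΦ, abs_div, abs_of_neg hl0, div_le_iff₀ (by linarith)]
  refine hlog.trans (mul_le_mul_of_nonneg_left (by linarith) (by linarith))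

/-- The number of empty bins for `N ≪ P` balls is concentrated if the balls are thrown with
`log₂ P`-wise independence. -/
theorem KWiseIndependent.bitProb_emptyBins_le {r p : ℕ} {α : Type} [DecidableEq α]
    {h : (Fin r → Bool) → α → Fin (2 ^ p)} (hh : KWiseIndependent p h) (hp : 4 ≤ p) (A : Finset α)
    (hA0 : 0 < A.card) (hA : (A.card : ℝ) ≤ 2 ^ p / 64) {ε : ℝ} (hε : 0 < ε) :
    bitProb {ω | ε / 4 * A.card ≤ |(emptyBins A (h ω) : ℝ)
        - (2 : ℝ) ^ p * (1 - 1 / (2 : ℝ) ^ p) ^ A.card|} ≤ 48 / (2 ^ p * ε ^ 2) := by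
  have h2p : (2 : ℝ) ^ 4 ≤ 2 ^ p := pow_le_pow_right₀ (by norm_num) hp
  have key := hh.expect_emptyBins_sub_sq_le A (by
    rw [Fintype.card_fin]
    exact Nat.le_self_pow (by omega) 2)
  rw [Fintype.card_fin] at key
  push_cast at key
  set P : ℝ := 2 ^ p with hP
  set N : ℝ := (A.card : ℝ) with hN
  have hP0 : 0 < P := by positivity
  have hN0 : 0 < N := by rw [hN]; exact_mod_cast hA0
  have hNP : 2 * N / P ≤ 1 / 32 := by
    rw [div_le_iff₀ hP0]
    linarith
  -- Here `p`-wise independence proves sufficient: `2 N / P ≤ 1/32` and `32 ^ p = P ^ 5`, so the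
  -- truncation error drops below the variance bound.
  have herr : 8 * P ^ 2 * (A.card.choose p * (2 / P) ^ p) ≤ N ^ 2 / P := by
    have h1 : (A.card.choose p : ℝ) ≤ N ^ p := by
      rw [hN]
      exact_mod_cast Nat.choose_le_pow A.card p
    have h2 : (1 / 32 : ℝ) ^ (p - 2) = 1024 / P ^ 5 := by
      have h3 : (1 / 32 : ℝ) ^ p = 1 / P ^ 5 := by
        rw [hP, ← pow_mul, mul_comm p 5, pow_mul, one_div_pow]
        norm_num
      rw [pow_sub₀ _ (by norm_num) (by omega), h3]
      ring
    calc 8 * P ^ 2 * (A.card.choose p * (2 / P) ^ p)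
        ≤ 8 * P ^ 2 * (N ^ p * (2 / P) ^ p) := by gcongr
      _ = 8 * P ^ 2 * ((2 * N / P) ^ 2 * (2 * N / P) ^ (p - 2)) := by
        rw [← mul_pow, ← pow_add, Nat.add_sub_cancel' (by omega : 2 ≤ p)]
        congr 2
        ring
      _ ≤ 8 * P ^ 2 * ((2 * N / P) ^ 2 * (1 / 32) ^ (p - 2)) := by gcongr
      _ = N ^ 2 / P * (32768 / P ^ 4) := by
        rw [h2]
        field_simp
        ring
      _ ≤ N ^ 2 / P * 1 := by
        gcongr
        rw [div_le_one (by positivity)]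
        calc (32768 : ℝ) ≤ (2 ^ 4) ^ 4 := by norm_num
          _ ≤ P ^ 4 := by gcongr
      _ = _ := mul_one _
  refine le_trans (bitProb_mono ?_) ((bitProb_markov
    (fun ω => ((emptyBins A (h ω) : ℝ) - P * (1 - 1 / P) ^ A.card) ^ 2) (fun ω => sq_nonneg _)
    (τ := (ε / 4 * N) ^ 2) (by positivity)).trans ?_)
  · intro ω hω
    simp only [Set.mem_ofPred_eq] at hω ⊢
    rw [← sq_abs ((emptyBins A (h ω) : ℝ) - _)]
    gcongr
  · calc _ ≤ (2 * N ^ 2 / P + N ^ 2 / P) / (ε / 4 * N) ^ 2 := by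
          gcongr
          linarith
      _ = _ := by
          field_simp
          ring

section

variable {n a d b c₀ : ℕ} {ε C : ℝ} {H : KNWHash n (logP a ε) (logP a ε ^ 1)} {x : ℕ → Fin n}
  {f : ℕ → ℝ} {T : ℕ}

theorem bitProb_sampled_le (hT : Tracks C T x f) (hC : 1 ≤ C) (hc₀ : C ≤ 2 ^ c₀)
    (hd : c₀ + 9 ≤ d) (hε : 0 < ε) (hε1 : ε < 1) {t : ℕ} (ht : t ≤ T) (hF : 0 < F0 x t) :
    bitProb {u | ε / 4 * F0 x t ≤
      |(((seen x t).filter fun s => level d ε (f t) ≤ lsb (H.h₁ u s)).card : ℝ)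
        * 2 ^ level d ε (f t) - F0 x t|} ≤ 1 / 18 := by
  set D := level d ε (f t) with hD
  have hF0 : (0 : ℝ) < F0 x t := by exact_mod_cast hF
  rcases eq_or_ne D 0 with h0 | h0
  · have : {u | ε / 4 * F0 x t ≤ |(((seen x t).filter fun s => D ≤ lsb (H.h₁ u s)).card : ℝ)
        * 2 ^ D - F0 x t|} = ∅ := by
      ext u
      simp only [Set.mem_ofPred_eq, Set.mem_empty_iff_false, iff_false, not_le, h0, Nat.zero_le,
        filter_true, pow_zero, mul_one]
      rw [F0, sub_self, abs_zero]
      have : (0 : ℝ) < (seen x t).card := hF0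
      positivity
    rw [this]
    simp [bitProb]
  · have h1 := hT.two_pow_le hC hε ht h0
    rw [← hD] at h1
    have hFn : (F0 x t : ℝ) ≤ n := by
      exact_mod_cast (card_le_univ (seen x t)).trans_eq (Fintype.card_fin n)
    -- The sampling probability is exactly `2⁻ᴰ` only up to the bit length of the hash values.
    have hDm : D ≤ Nat.clog 2 n := by
      have h2 : (2 : ℝ) ^ (d + D) ≤ 2 ^ (c₀ + Nat.clog 2 n) := by
        have h3 : (n : ℝ) ≤ 2 ^ Nat.clog 2 n := by
          exact_mod_cast Nat.le_pow_clog (by norm_num) n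
        calc (2 : ℝ) ^ (d + D) ≤ C * F0 x t * ε ^ 2 := h1
          _ ≤ C * F0 x t * 1 := by gcongr; exact pow_le_one₀ hε.le hε1.le
          _ ≤ 2 ^ c₀ * 2 ^ Nat.clog 2 n * 1 := by
            gcongr
            exact hFn.trans h3
          _ = _ := by rw [pow_add]; ring
      have := (pow_le_pow_iff_right₀ (by norm_num : (1 : ℝ) < 2)).1 h2
      omega
    have : Nonempty (Fin (2 ^ Nat.clog 2 n)) := ⟨⟨0, by positivity⟩⟩
    have key := H.indep₁.bitProb_abs_sub_le (by norm_num) (seen x t)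
      (fun v => if D ≤ lsb v then (1 : ℝ) else 0) (τ := ε / 4 * F0 x t / 2 ^ D) (by positivity)
    have hsq : ∀ v : Fin (2 ^ Nat.clog 2 n),
        (if D ≤ lsb v then (1 : ℝ) else 0) ^ 2 = if D ≤ lsb v then (1 : ℝ) else 0 := by
      intro v
      split_ifs <;> norm_num
    simp_rw [hsq] at key
    rw [expect_le_lsb hDm] at key
    refine le_trans (bitProb_mono fun u hu => ?_) (key.trans ?_)
    · simp only [Set.mem_ofPred_eq, sum_boole] at hu ⊢
      rw [div_le_iff₀ (by positivity), ← abs_of_pos (by positivity : (0 : ℝ) < 2 ^ D), ← abs_mul,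
        abs_of_pos (by positivity : (0 : ℝ) < 2 ^ D), sub_mul,
        inv_mul_cancel_right₀ (by positivity)]
      exact hu
    · change (F0 x t : ℝ) * _ / _ ≤ _
      have e : (F0 x t : ℝ) * (2 ^ D)⁻¹ / (ε / 4 * F0 x t / 2 ^ D) ^ 2
          = 16 * 2 ^ D / (ε ^ 2 * F0 x t) := by
        field_simp
        norm_num
      rw [e, div_le_div_iff₀ (by positivity) (by norm_num)]
      have h5 : (2 : ℝ) ^ (d + D) ≥ 2 ^ (c₀ + 9) * 2 ^ D := by
        rw [← pow_add]
        exact pow_le_pow_right₀ (by norm_num) (by omega)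
      -- The 9 in `c₀ + 9 ≤ d` gives an expected sample of at least `512 / ε ^ 2`, so Chebyshev's
      -- bound is at most `16 / 512`.
      have h6 : C * (512 * 2 ^ D) ≤ C * (F0 x t * ε ^ 2) := by
        calc C * (512 * 2 ^ D) ≤ 2 ^ c₀ * (512 * 2 ^ D) := by gcongr
          _ = 2 ^ (c₀ + 9) * 2 ^ D := by rw [pow_add]; ring
          _ ≤ C * F0 x t * ε ^ 2 := h5.le.trans h1
          _ = _ := by ring
      have h7 := le_of_mul_le_mul_left h6 (by linarith)
      have : (0 : ℝ) < 2 ^ D := by positivity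
      linarith

/-- Error budget: `(ε / 2) (5 / 4) + ε / 4 < ε`. -/
theorem mul_mem_Icc_of_abs_sub_le {ε F N Φ Q : ℝ} (hε : 0 < ε) (hε1 : ε < 1) (hF : 0 < F)
    (hQ : 0 < Q) (h : |Φ - N| ≤ 2 * (ε / 4 * N)) (hN : |N * Q - F| < ε / 4 * F) :
    (1 - ε) * F ≤ Φ * Q ∧ Φ * Q ≤ (1 + ε) * F := by
  rw [abs_lt] at hN
  rw [abs_le] at h
  have h4 : Φ * Q - N * Q ≤ ε / 2 * (N * Q) := by nlinarith
  have h5 : -(ε / 2 * (N * Q)) ≤ Φ * Q - N * Q := by nlinarith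
  have h6 : ε / 2 * (N * Q) ≤ ε / 2 * (5 / 4 * F) := by
    refine mul_le_mul_of_nonneg_left ?_ (by linarith)
    nlinarith
  constructor <;> nlinarith

theorem five_sixths_le_bitProb (hT : Tracks C T x f) (hC : 1 ≤ C) (hc₀ : C ≤ 2 ^ c₀)
    (hd : c₀ + 9 ≤ d) (ha : c₀ + d + 14 ≤ a) (hb : ⌈Real.logb 2 (2 * C ^ 2)⌉₊ ≤ b)
    (hε : 0 < ε) (hε1 : ε < 1) {t : ℕ} (ht : t ≤ T) :
    5 / 6 ≤ bitProb {ω | (1 - ε) * (F0 x t : ℝ) ≤ (knw a d b ε H).estimate x f ω t ∧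
      (knw a d b ε H).estimate x f ω t ≤ (1 + ε) * (F0 x t : ℝ)} := by
  have hlev : ∀ t' ≤ t, level d ε (f t') ≤ level d ε (f t) + b := by
    intro t' ht'
    have hF : (F0 x t' : ℝ) ≤ 2 * F0 x t := by
      have h1 : (F0 x t' : ℝ) ≤ F0 x t := by exact_mod_cast F0_mono x ht'
      have h2 : (0 : ℝ) ≤ F0 x t := Nat.cast_nonneg _
      linarith
    have := hT.level_le hC hε d ht (ht'.trans ht) hF
    omega
  have hPlow := le_two_pow_logP a hε
  have hap : a ≤ logP a ε := by
    rw [logP]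
    omega
  set D := level d ε (f t) with hD
  rcases Nat.eq_zero_or_pos (F0 x t) with hF | hF
  · have : ∀ ω, (knw a d b ε H).estimate x f ω t = 0 := by
      intro ω
      rw [estimate_eq t hlev, card_eq_zero.1 hF]
      simp [emptyBins, PhiInv]
    simp only [hF, this]
    simp only [CharP.cast_eq_zero, mul_zero, le_refl, and_self]
    refine le_trans (by norm_num) (bitProb_univ H.bits).ge
  have hF0 : (0 : ℝ) < F0 x t := by exact_mod_cast hF
  let S : (Fin n → Fin (2 ^ Nat.clog 2 n)) → Finset (Fin n) := fun h =>
    (seen x t).filter fun s => D ≤ lsb (h s)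
  -- few enough elements are sampled
  have hsmall : ∀ h : Fin n → Fin (2 ^ Nat.clog 2 n),
      |((S h).card : ℝ) * 2 ^ D - F0 x t| < ε / 4 * F0 x t →
      0 < (S h).card ∧ ((S h).card : ℝ) ≤ 2 ^ logP a ε / 64 := by
    intro h hA
    rw [abs_lt] at hA
    constructor
    · by_contra h0
      have : (S h).card = 0 := by omega
      rw [this] at hA
      norm_num at hA
      nlinarith
    · have h1 := hT.F0_mul_le hC hε d ht
      rw [← hD] at h1
      have h2 : ((S h).card : ℝ) * 2 ^ D ≤ 2 * F0 x t := by nlinarith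
      have h3 : ((S h).card : ℝ) * ε ^ 2 * 2 ^ D ≤ C * 2 ^ (d + 2) * 2 ^ D := by
        calc _ = ((S h).card : ℝ) * 2 ^ D * ε ^ 2 := by ring
          _ ≤ 2 * F0 x t * ε ^ 2 := by gcongr
          _ ≤ 2 * (C * 2 ^ (d + D + 1)) := by linarith
          _ = _ := by ring
      have h4 := le_of_mul_le_mul_right h3 (by positivity)
      -- This is where `a` must exceed `c₀ + d`: a larger `d` means more sampled elements, hence
      -- more bins.
      have h5 : C * 2 ^ (d + 2) * 64 ≤ 2 ^ a := by
        calc C * 2 ^ (d + 2) * 64 ≤ 2 ^ c₀ * 2 ^ (d + 2) * 2 ^ 6 := by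
              gcongr
              norm_num
          _ = 2 ^ (c₀ + (d + 2) + 6) := by rw [pow_add _ (c₀ + (d + 2)), pow_add _ c₀]
          _ ≤ 2 ^ a := pow_le_pow_right₀ (by norm_num) (by omega)
      refine le_trans ?_ (div_le_div_of_nonneg_right hPlow (by norm_num))
      rw [div_div, le_div_iff₀ (by positivity)]
      linarith
  let bad₁ : Set (Fin H.bits → Bool) :=
    {ω | ε / 4 * F0 x t ≤ |((S (H.hash₁ ω)).card : ℝ) * 2 ^ D - F0 x t|}
  -- Each later event includes the success of the earlier stages. Once the earlier blocks of bits
  -- are frozen, it is either impossible or covered by the bound for the one remaining hash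
  -- function.
  let bad₂ : Set (Fin H.bits → Bool) := {ω |
    0 < (S (H.hash₁ ω)).card ∧ ((S (H.hash₁ ω)).card : ℝ) ≤ 2 ^ logP a ε / 64 ∧
    ¬ Set.InjOn (H.h₃ fun i => ω (Fin.castAdd H.r₄ (Fin.natAdd H.r₁ i))) (S (H.hash₁ ω))}
  let bad₃ : Set (Fin H.bits → Bool) := {ω |
    0 < (S (H.hash₁ ω)).card ∧ ((S (H.hash₁ ω)).card : ℝ) ≤ 2 ^ logP a ε / 64 ∧
    Set.InjOn (H.h₃ fun i => ω (Fin.castAdd H.r₄ (Fin.natAdd H.r₁ i))) (S (H.hash₁ ω)) ∧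
    ε / 4 * (S (H.hash₁ ω)).card ≤ |(emptyBins (S (H.hash₁ ω)) (H.hash₂ ω) : ℝ)
        - (2 : ℝ) ^ logP a ε * (1 - 1 / (2 : ℝ) ^ logP a ε) ^ (S (H.hash₁ ω)).card|}
  have hbad₁ : bitProb bad₁ ≤ 1 / 18 :=
    (bitProb_hash₁_le H fun h => ε / 4 * F0 x t ≤ |((S h).card : ℝ) * 2 ^ D - F0 x t|).trans
      (bitProb_sampled_le hT hC hc₀ hd hε hε1 ht hF)
  have hbad₂ : bitProb bad₂ ≤ 1 / 18 := by
    refine bitProb_le_of_forall_right fun w => bitProb_le_of_forall_left fun u => ?_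
    by_cases hs : ((S (H.h₁ u)).card : ℝ) ≤ 2 ^ logP a ε / 64
    · refine le_trans (bitProb_mono fun v hv => ?_)
        ((H.indep₃.bitProb_not_injOn_le (S (H.h₁ u))).trans ?_)
      · have h1 := hv.2.2
        rw [hash₁_append H u v w] at h1
        simpa using h1
      · rw [Fintype.card_fin, Nat.cast_pow, Nat.cast_pow, Nat.cast_ofNat, ← div_pow]
        have : ((S (H.h₁ u)).card : ℝ) / 2 ^ logP a ε ≤ 1 / 64 := by
          rw [div_le_iff₀ (by positivity)]
          linarith
        calc (((S (H.h₁ u)).card : ℝ) / 2 ^ logP a ε) ^ 2 ≤ (1 / 64) ^ 2 := by gcongr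
          _ ≤ _ := by norm_num
    · refine le_trans (bitProb_mono (E' := ∅) fun v hv => ?_) (by simp [bitProb])
      have h1 := hv.2.1
      rw [hash₁_append H u v w] at h1
      exact hs h1
  have hbad₃ : bitProb bad₃ ≤ 1 / 18 := by
    refine bitProb_le_of_forall_left fun uv => ?_
    obtain ⟨⟨u, v⟩, rfl⟩ := (Fin.appendEquiv H.r₁ H.r₃).surjective uv
    change bitProb {w : Fin H.r₄ → Bool | Fin.append (Fin.append u v) w ∈ bad₃} ≤ 1 / 18
    by_cases hs : 0 < (S (H.h₁ u)).card ∧ ((S (H.h₁ u)).card : ℝ) ≤ 2 ^ logP a ε / 64 ∧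
        Set.InjOn (H.h₃ v) (S (H.h₁ u))
    · have hcard : ((S (H.h₁ u)).image (H.h₃ v)).card = (S (H.h₁ u)).card :=
        card_image_of_injOn hs.2.2
      have key := KWiseIndependent.bitProb_emptyBins_le (H.indep₄.mono (pow_one _).ge) (by omega)
        ((S (H.h₁ u)).image (H.h₃ v)) (by rw [hcard]; exact hs.1) (by rw [hcard]; exact hs.2.1) hε
      rw [hcard] at key
      refine le_trans (bitProb_mono fun w hw => ?_) (key.trans ?_)
      · have h1 := hw.2.2.2
        rw [hash₁_append H u v w, hash₂_append H u v w] at h1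
        simp only [Set.mem_ofPred_eq]
        rw [emptyBins_image]
        exact h1
      · rw [div_le_div_iff₀ (by positivity) (by norm_num)]
        rw [div_le_iff₀ (by positivity)] at hPlow
        have : (2 : ℝ) ^ 14 ≤ 2 ^ a := pow_le_pow_right₀ (by norm_num) (by omega)
        linarith
    · refine le_trans (bitProb_mono (E' := ∅) fun w hw => ?_) (by simp [bitProb])
      obtain ⟨h1, h2, h3, -⟩ := hw
      rw [hash₁_append H u v w] at h1 h2 h3
      exact hs ⟨h1, h2, by simpa using h3⟩
  have hunion : bitProb (bad₁ ∪ (bad₂ ∪ bad₃)) ≤ 1 / 6 := by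
    refine (bitProb_union_le _ _).trans ?_
    have : bitProb (bad₂ ∪ bad₃) ≤ 1 / 18 + 1 / 18 :=
      (bitProb_union_le bad₂ bad₃).trans (add_le_add hbad₂ hbad₃)
    linarith
  refine le_trans ?_ (bitProb_mono (E := (bad₁ ∪ (bad₂ ∪ bad₃))ᶜ) fun ω hω => ?_)
  · rw [bitProb_compl]
    linarith
  · simp only [Set.mem_compl_iff, Set.mem_union, not_or] at hω
    obtain ⟨h1, h2, h3⟩ := hω
    have hA : |((S (H.hash₁ ω)).card : ℝ) * 2 ^ D - F0 x t| < ε / 4 * F0 x t := not_le.1 h1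
    obtain ⟨hN0, hNP⟩ := hsmall _ hA
    have hinj : Set.InjOn (H.h₃ fun i => ω (Fin.castAdd H.r₄ (Fin.natAdd H.r₁ i)))
        (S (H.hash₁ ω)) := by
      by_contra hc
      exact h2 ⟨hN0, hNP, hc⟩
    have hV : |(emptyBins (S (H.hash₁ ω)) (H.hash₂ ω) : ℝ)
        - (2 : ℝ) ^ logP a ε * (1 - 1 / (2 : ℝ) ^ logP a ε) ^ (S (H.hash₁ ω)).card|
        ≤ ε / 4 * (S (H.hash₁ ω)).card := by
      by_contra! hc
      exact h3 ⟨hN0, hNP, hinj, hc.le⟩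
    have hest := abs_PhiInv_sub_le (P := 2 ^ logP a ε) (N := (S (H.hash₁ ω)).card)
      (V := (emptyBins (S (H.hash₁ ω)) (H.hash₂ ω) : ℝ)) (δ := ε / 4 * (S (H.hash₁ ω)).card)
      (Nat.le_self_pow (by omega) 2) (by push_cast; exact hNP)
      -- `ε / 4 * (P / 64) ≤ P / 256`, which is the accuracy that inverting `Φ` demands.
      (by
        push_cast
        have : (0 : ℝ) ≤ (S (H.hash₁ ω)).card := Nat.cast_nonneg _
        nlinarith)
      (by push_cast; exact hV)
    have he := estimate_eq (a := a) (d := d) (b := b) (H := H) (x := x) (f := f) (ω := ω) t hlev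
    push_cast at hest
    simp only [Set.mem_ofPred_eq]
    rw [he]
    exact mul_mem_Icc_of_abs_sub_le hε hε1 hF0 (by positivity) hest hA

end

end DistinctElements

/-! ### Choice of the constants. -/

open DistinctElements
theorem mainTheorem8 (C : ℝ) (hC : 1 ≤ C) :
    ∃ (a d b e j : ℕ) (K C₂ C₃ c lam₀ : ℝ), 0 < c ∧
      ∀ (n : ℕ), 1 ≤ n → ∀ (ε : ℝ), 0 < ε → ε < 1 →
        -- hash functions as required exist with few random bits
        (∃ H : KNWHash n (logP a ε) (logP a ε ^ e),
          (H.bits : ℝ) ≤ K * (1 + Real.log n + Real.log (1 / ε) ^ j)) ∧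
        -- and with any such hash functions the algorithm has the following guarantees
        ∀ (H : KNWHash n (logP a ε) (logP a ε ^ e)) (T : ℕ) (x : ℕ → Fin n) (f : ℕ → ℝ),
          Tracks C T x f →
          (∀ t ≤ T, 5 / 6 ≤ bitProb {ω |
            (1 - ε) * (F0 x t : ℝ) ≤ (knw a d b ε H).estimate x f ω t ∧
            (knw a d b ε H).estimate x f ω t ≤ (1 + ε) * (F0 x t : ℝ)}) ∧
          (∀ t ≤ T, bitProb {ω | C₂ / ε ^ 2 < ((knw a d b ε H).space x f ω t : ℝ)} ≤ ε ^ 4) ∧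
          (∀ t ≤ T, ∀ lam : ℝ, lam₀ ≤ lam →
            bitProb {ω | lam / ε ^ 2 < ((knw a d b ε H).space x f ω t : ℝ)}
              ≤ Real.exp (-Real.exp (c * lam))) ∧
          (∀ t₁ t₂ : ℕ, t₁ < t₂ → t₂ ≤ T → (F0 x t₂ : ℝ) / 2 ≤ (F0 x t₁ : ℝ) →
            ∀ ω, ((knw a d b ε H).space x f ω t₁ : ℝ)
              ≤ ((knw a d b ε H).space x f ω t₂ : ℝ) + C₃ / ε ^ 2) := by
  obtain ⟨c₀, hc₀⟩ := pow_unbounded_of_one_lt C (by norm_num : (1 : ℝ) < 2)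
  set q := ⌈Real.logb 2 (2 * C ^ 2)⌉₊ with hq
  set d := c₀ + 9 with hd
  set a := c₀ + d + 14 with ha
  -- The margin `b` is the largest possible drift `q` of the level, and `e = 1` makes `h₄` just
  -- `p`-wise independent. Its seed has `O(p²)` bits, whence `j = 2`; `K` is read off from
  -- `exists_knwHash`.
  refine ⟨a, d, q, 1, 2, _, 2 ^ (a + 1) + 9216 * (C * 2 ^ (d + q + 1)), 2 ^ (a + 1) * (2 * q),
    Real.log 2 / 2 ^ (a + 3), max (2 ^ (a + 1) + 9216 * (C * 2 ^ (d + q + 1)))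
      ((10 + 6 * Real.log (2 * (C * 2 ^ (d + q + 1)))) / (Real.log 2 / 2 ^ (a + 3))),
    div_pos (Real.log_pos (by norm_num)) (by positivity), fun n hn ε hε hε1 =>
    ⟨exists_knwHash hn hε hε1 a, fun H T x f hT => ⟨fun t ht => ?_, fun t ht => ?_,
      fun t ht lam hlam => ?_, fun t₁ t₂ h12 h2T hF ω => ?_⟩⟩⟩
  · exact five_sixths_le_bitProb hT hC hc₀.le le_rfl le_rfl le_rfl hε hε1 ht
  · exact bitProb_lt_space_le hT hC hε hε1 ht
  · exact bitProb_lt_space_le_exp hT hC hε hε1 ht ((le_max_left _ _).trans hlam)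
      ((le_max_right _ _).trans hlam)
  · have hsp := space_le_space_add (a := a) (d := d) (b := q) (H := H) (x := x) (f := f) h12.le
      (fun t' _ h' => hT.level_le hC hε d (h12.le.trans h2T) (h'.trans h2T) (by
        have : (F0 x t' : ℝ) ≤ F0 x t₂ := by exact_mod_cast F0_mono x h'
        linarith)) ω
    have hP := two_pow_logP_le a hε hε1
    have hsp' : ((knw a d q ε H).space x f ω t₁ : ℝ)
        ≤ ((knw a d q ε H).space x f ω t₂ : ℝ) + 2 ^ logP a ε * (2 * q) := by
      exact_mod_cast hsp
    refine hsp'.trans ?_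
    rw [mul_div_right_comm]
    gcongr
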